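/- Let $\lambda>0$, $p\in[0,1]$, $d_h,d_v>0$. The roads of a city form a Manhattan Poisson line process: the ordinates of the horizontal roads and the abscissas of the vertical roads are two independent homogeneous Poisson point processes on $\mathbb{R}$ with intensity $\lambda$. A trip goes from a given point $S$ to a given point $D$ with horizontal offset $|D_1-S_1|=d_h$ and vertical offset $|D_2-S_2|=d_v$. Besides the roads of the line process there is one road through $S$ (the source road) and one road through $D$ (the destination road). With probability $1/2$ these two roads are parallel, and with probability $1/2$ they are perpendicular, independently of everything else. By convention, both are vertical in the parallel case, and the source road is horizontal and the destination road is vertical in the perpendicular case. Every road, including the source and destination roads, is a charging road with probability $p$, independently of the other roads and of the positions of the roads. The driver travels along roads from $S$ to $D$ on a shortest route and, among the shortest routes, on one with the greatest length of charging road. Let $T_c$ be the event that this route uses at least one charging road (that is, travels a positive distance on charging roads; merely crossing a charging road does not count). Let $E_4$ (respectively $E_8$) be the event that the source and destination roads are parallel (respectively perpendicular) and both are not charging. Then almost surely a route prescribed by this policy exists, $T_c$ is an event (up to null sets), and $$\mathbb{P}(T_c)=1-\sum_{i=4,8}\mathbb{P}(\overline{T_c}\mid E_i)\,\mathbb{P}(E_i),$$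 where $$\mathbb{P}(\overline{T_c}\mid E_4)\mathbb{P}(E_4)=\Big[e^{-\lambda d_v}(1-p)+\lambda(1-p)d_v\,e^{-\lambda(1-p)d_v}e^{-\lambda p d_v}+e^{-\lambda p d_v}\big(1-e^{-\lambda(1-p)d_v}-\lambda(1-p)d_v\,e^{-\lambda(1-p)d_v}\big)e^{-\lambda p d_h}\Big]\frac{(1-p)^2}{2},$$ $$\mathbb{P}(\overline{T_c}\mid E_8)\mathbb{P}(E_8)=\Big[e^{-\lambda d_v}+e^{-\lambda p d_v}\big(1-e^{-\lambda(1-p)d_v}\big)e^{-\lambda p d_h}+\big(1-e^{-\lambda p d_v}\big)e^{-\lambda d_h}\Big]\frac{(1-p)^2}{2}.$$ (When $\mathbb{P}(E_i)=0$ the product $\mathbb{P}(\overline{T_c}\mid E_i)\mathbb{P}(E_i)$ is $0$.) -/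

import Mathlib

open MeasureTheory ProbabilityTheory

noncomputable section

namespace ChargingRoads

/-! ## Poisson point processes on the line -/

/-- The number of points of the random collection `X 0 ω, X 1 ω, …` that lie in `B`. -/
def pointCount {Ω : Type*} (X : ℕ → Ω → ℝ) (B : Set ℝ) (ω : Ω) : ℕ∞ :=
  {k : ℕ | X k ω ∈ B}.encard

/-- The random collection `{X k | k ∈ ℕ}` of distinct points of `ℝ` (listed in an arbitrary
measurable way) is a homogeneous Poisson point process with intensity `lam`. -/
structure IsPoissonProcess {Ω : Type*} [MeasurableSpace Ω] (P : Measure Ω) (lam : ℝ)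
    (X : ℕ → Ω → ℝ) : Prop where
  measurable : ∀ k, Measurable (X k)
  distinct : ∀ᵐ ω ∂P, Function.Injective fun k => X k ω
  count_law : ∀ B : Set ℝ, MeasurableSet B → volume B ≠ ⊤ → ∀ n : ℕ,
    P {ω | pointCount X B ω = n} =
      ENNReal.ofReal ((lam * (volume B).toReal) ^ n / n.factorial *
        Real.exp (-(lam * (volume B).toReal)))
  count_indep : ∀ (m : ℕ) (B : Fin m → Set ℝ), (∀ j, MeasurableSet (B j)) →
    Pairwise (fun i j => Disjoint (B i) (B j)) → iIndepFun (fun j => pointCount X (B j)) P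

/-! ## Road networks, routes and the routing policy -/

inductive Orientation
  | horizontal
  | vertical

/-- A system of horizontal and vertical roads (full lines) in the plane. The offset of a
horizontal road is its ordinate, the offset of a vertical road is its abscissa. -/
structure RoadNetwork (ι : Type*) where
  orientation : ι → Orientation
  offset : ι → ℝ
  charging : ι → Bool

/-- The points of the `i`-th road. -/
def RoadNetwork.road {ι : Type*} (N : RoadNetwork ι) (i : ι) : Set (ℝ × ℝ) :=
  match N.orientation i with
  | .horizontal => {q | q.2 = N.offset i}
  | .vertical => {q | q.1 = N.offset i}

def manhattanDist (a b : ℝ × ℝ) : ℝ := |a.1 - b.1| + |a.2 - b.2|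

/-- A route from one point to another: a finite succession of straight drives, each from a point
of a road to another point of the same road. -/
inductive Route {ι : Type*} (N : RoadNetwork ι) : ℝ × ℝ → ℝ × ℝ → Type _
  | arrive (a : ℝ × ℝ) : Route N a a
  | drive {a b c : ℝ × ℝ} (i : ι) (ha : a ∈ N.road i) (hb : b ∈ N.road i)
      (rest : Route N b c) : Route N a c

namespace Route

variable {ι : Type*} {N : RoadNetwork ι}

/-- The length of a route. -/
def length {S D : ℝ × ℝ} : Route N S D → ℝ
  | arrive _ => 0
  | drive (a := a) (b := b) _ _ _ rest => manhattanDist a b + rest.length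

/-- The length that is driven on charging roads. -/
def chargingLength {S D : ℝ × ℝ} : Route N S D → ℝ
  | arrive _ => 0
  | drive (a := a) (b := b) i _ _ rest =>
      (if N.charging i = true then manhattanDist a b else 0) + rest.chargingLength

def IsShortest {S D : ℝ × ℝ} (r : Route N S D) : Prop :=
  ∀ r' : Route N S D, r.length ≤ r'.length

/-- The routing policy: a shortest route and, among the shortest routes, one with the most
charging road. -/
def IsPolicyRoute {S D : ℝ × ℝ} (r : Route N S D) : Prop :=
  r.IsShortest ∧ ∀ r' : Route N S D, r'.IsShortest → r'.chargingLength ≤ r.chargingLength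

end Route

/-! ## The random road network of a trip -/

/-- The source and the destination lie either on two parallel roads or on two perpendicular
roads. -/
inductive Placement
  | parallel
  | perpendicular

instance : MeasurableSpace Placement := ⊤

/-- The roads: the one through the source, the one through the destination, and the other
horizontal and vertical roads of the network. -/
inductive RoadIndex
  | source
  | destination
  | horizontal (k : ℕ)
  | vertical (k : ℕ)

/-- The random data of a trip: a Manhattan Poisson line process with intensity `lam` (two
independent Poisson processes of horizontal and of vertical roads), the placement of the trip
(parallel or perpendicular with probability `1/2` each), and the charging status of every road,
the two roads through the source and the destination included: independent over the roads,
charging with probability `p`. -/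
structure TripModel {Ω : Type*} [MeasurableSpace Ω] (P : Measure Ω) (lam p : ℝ) where
  /-- ordinates of the horizontal roads -/
  hor : ℕ → Ω → ℝ
  /-- abscissas of the vertical roads -/
  ver : ℕ → Ω → ℝ
  /-- charging status of the roads -/
  charging : RoadIndex → Ω → Bool
  placement : Ω → Placement
  hor_poisson : IsPoissonProcess P lam hor
  ver_poisson : IsPoissonProcess P lam ver
  charging_measurable : ∀ i, Measurable (charging i)
  charging_law : ∀ i, P {ω | charging i ω = true} = ENNReal.ofReal p
  charging_indep : iIndepFun charging P
  placement_measurable : Measurable placement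
  placement_law : P {ω | placement ω = .parallel} = 1 / 2
  indep_hor_ver : IndepFun (fun ω k => hor k ω) (fun ω k => ver k ω) P
  indep_charging : IndepFun (fun ω => ((fun k => hor k ω), (fun k => ver k ω)))
    (fun ω i => charging i ω) P
  indep_placement : IndepFun
    (fun ω => (((fun k => hor k ω), (fun k => ver k ω)), (fun i => charging i ω))) placement P

namespace TripModel

variable {Ω : Type*} [MeasurableSpace Ω] {P : Measure Ω} {lam p : ℝ}

/-- The road network of a trip from `S` to `D`: the roads of the line process together with a
road through `S` and a road through `D`. Parallel placement: both of these are vertical.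
Perpendicular placement: the one through `S` is horizontal and the one through `D` is
vertical. -/
def network (M : TripModel P lam p) (S D : ℝ × ℝ) (ω : Ω) : RoadNetwork RoadIndex where
  orientation
    | .source => match M.placement ω with
      | .parallel => .vertical
      | .perpendicular => .horizontal
    | .destination => .vertical
    | .horizontal _ => .horizontal
    | .vertical _ => .vertical
  offset
    | .source => match M.placement ω with
      | .parallel => S.1
      | .perpendicular => S.2
    | .destination => D.1
    | .horizontal k => M.hor k ω
    | .vertical k => M.ver k ω
  charging i := M.charging i ω

/-- The event that the trip uses at least one charging road: the route prescribed by the policy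
has a part of positive length on charging roads. (All routes that obey the policy have the same
charging length.) -/
def Tc (M : TripModel P lam p) (S D : ℝ × ℝ) : Set Ω :=
  {ω | ∃ r : Route (M.network S D ω) S D, r.IsPolicyRoute ∧ 0 < r.chargingLength}

/-- Source and destination on two parallel roads, both not charging. -/
def E4 (M : TripModel P lam p) : Set Ω :=
  {ω | M.placement ω = .parallel ∧
    M.charging .source ω = false ∧ M.charging .destination ω = false}

/-- Source and destination on two perpendicular roads, both not charging. -/
def E8 (M : TripModel P lam p) : Set Ω :=
  {ω | M.placement ω = .perpendicular ∧
    M.charging .source ω = false ∧ M.charging .destination ω = false}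

end TripModel

end ChargingRoads

end

/-! Almost surely the roads are in general position (`ae_generic`): locally finite, distinct,
avoiding the coordinates of `S` and `D`, and with no two horizontal roads mirroring each other about
the midpoint of the heights of `S` and `D`. On such an outcome everything is deterministic geometry.

A policy route exists because routes can be normalised to turn only at crossings. Then only finitely
many pairs (length, plain length) stay below a given length (`Route.exists_isPolicyRoute`). So the
trip uses charging exactly if some shortest route has positive charging length, and
`Generic.mem_Tc_iff` decides this case by case.

Between parallel roads a route must cross on some horizontal road, and the shortest length is the
horizontal distance plus the least `detour`. General position excludes ties except among roads
between `S` and `D`. If the minimiser is unique, only that road and the two end roads matter. If two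
horizontal roads lie in between, every charging road of the rectangle, horizontal or vertical, can
be used. Between perpendicular roads the L-shaped route is already direct. Leaving it without loss
takes a road of each orientation in the rectangle; given both, any charging road there can be used.

For the probabilities, a failure event is split according to the finite set of indices of the roads
that must not be charging (`patternEvent`). With that set fixed, independence applies and each road
contributes a factor `1 - p`. Summing over index sets grouped by cardinality is a Poisson generating
function (`weight_pointsEq`), which is where the thinned exponentials come from. -/

namespace ChargingRoads

/-! ## Elementary properties of routes -/

lemma manhattanDist_nonneg (a b : ℝ × ℝ) : 0 ≤ manhattanDist a b := by
  unfold manhattanDist; positivity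

lemma manhattanDist_self (a : ℝ × ℝ) : manhattanDist a a = 0 := by
  simp [manhattanDist]

lemma manhattanDist_triangle (a b c : ℝ × ℝ) :
    manhattanDist a c ≤ manhattanDist a b + manhattanDist b c := by
  unfold manhattanDist
  have h1 := abs_sub_le a.1 b.1 c.1
  have h2 := abs_sub_le a.2 b.2 c.2
  linarith

lemma manhattanDist_pos {a b : ℝ × ℝ} (h : a ≠ b) : 0 < manhattanDist a b := by
  refine lt_of_le_of_ne (manhattanDist_nonneg a b) fun h0 => h ?_
  unfold manhattanDist at h0
  have h1 := abs_nonneg (a.1 - b.1)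
  have h2 := abs_nonneg (a.2 - b.2)
  have h3 : |a.1 - b.1| = 0 := by linarith
  have h4 : |a.2 - b.2| = 0 := by linarith
  exact Prod.ext (sub_eq_zero.1 (abs_eq_zero.1 h3)) (sub_eq_zero.1 (abs_eq_zero.1 h4))

lemma RoadNetwork.mem_road_horizontal {ι : Type*} {N : RoadNetwork ι} {i : ι}
    (h : N.orientation i = .horizontal) (a : ℝ × ℝ) : a ∈ N.road i ↔ a.2 = N.offset i := by
  simp [RoadNetwork.road, h]

lemma RoadNetwork.mem_road_vertical {ι : Type*} {N : RoadNetwork ι} {i : ι}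
    (h : N.orientation i = .vertical) (a : ℝ × ℝ) : a ∈ N.road i ↔ a.1 = N.offset i := by
  simp [RoadNetwork.road, h]

namespace Route

variable {ι : Type*} {N : RoadNetwork ι}

/-- The length that is driven on roads that are not charging. -/
def plainLength {S D : ℝ × ℝ} : Route N S D → ℝ
  | arrive _ => 0
  | drive (a := a) (b := b) i _ _ rest =>
      (if N.charging i = true then 0 else manhattanDist a b) + rest.plainLength

/-- At equal length, maximising charging length is minimising plain length. The latter, like length,
does not grow under shortcuts, so both policy criteria become minimisations. -/
lemma plainLength_add_chargingLength {S D : ℝ × ℝ} (r : Route N S D) :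
    r.plainLength + r.chargingLength = r.length := by
  induction r with
  | arrive a => simp [plainLength, chargingLength, length]
  | drive i ha hb rest ih =>
    simp only [plainLength, chargingLength, length]
    split_ifs <;> linarith

lemma manhattanDist_le_length {S D : ℝ × ℝ} (r : Route N S D) :
    manhattanDist S D ≤ r.length := by
  induction r with
  | arrive a => simp [length, manhattanDist]
  | @drive a b c i ha hb rest ih =>
    have := manhattanDist_triangle a b c
    simp only [length]
    linarith

lemma length_nonneg {S D : ℝ × ℝ} (r : Route N S D) : 0 ≤ r.length :=
  (manhattanDist_nonneg S D).trans r.manhattanDist_le_length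

/-! ## Existence of a policy route -/

/-- All drives of the route are non-degenerate and connect points of `G`. -/
def IsNormal (G : Set (ℝ × ℝ)) {S D : ℝ × ℝ} : Route N S D → Prop
  | arrive _ => True
  | drive (a := a) (b := b) _ _ _ rest => a ∈ G ∧ b ∈ G ∧ a ≠ b ∧ rest.IsNormal G

/-- Consecutive drives on one road are merged. In the induction, `g` is where the pending drive on
road `i` began and `a` is where it currently ends. The drive is emitted only when the route changes
roads, and then `a` lies on two roads, hence in `G`. -/
lemma exists_isNormal_of_mem_road {G : Set (ℝ × ℝ)}
    (hG : ∀ i j a, i ≠ j → a ∈ N.road i → a ∈ N.road j → a ∈ G)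
    {a D : ℝ × ℝ} (r : Route N a D) (hD : D ∈ G) (i : ι) (hai : a ∈ N.road i) (g : ℝ × ℝ)
    (hgi : g ∈ N.road i) (hg : g ∈ G) :
    ∃ r' : Route N g D, r'.IsNormal G ∧ r'.length ≤ manhattanDist g a + r.length ∧
      r'.plainLength ≤ (if N.charging i = true then 0 else manhattanDist g a) + r.plainLength := by
  induction r generalizing i g with
  | arrive a =>
    by_cases h : g = a
    · subst h
      exact ⟨arrive g, trivial, by simp [length, manhattanDist_self],
        by simp [plainLength, manhattanDist_self]⟩
    · exact ⟨drive i hgi hai (arrive a), ⟨hg, hD, h, trivial⟩, by simp [length],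
        by simp [plainLength]⟩
  | @drive a b c j ha hb rest ih =>
    by_cases hij : i = j
    · subst hij
      obtain ⟨r', h1, h2, h3⟩ := ih hD i hb g hgi hg
      have := manhattanDist_triangle g a b
      refine ⟨r', h1, by simp only [length]; linarith, ?_⟩
      simp only [plainLength]
      split_ifs at h3 ⊢ <;> linarith
    · have haG := hG i j a hij hai ha
      obtain ⟨r', h1, h2, h3⟩ := ih hD j hb a ha haG
      by_cases h : g = a
      · subst h
        exact ⟨r', h1, by simpa [length, manhattanDist_self] using h2,
          by simpa [plainLength, manhattanDist_self] using h3⟩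
      · refine ⟨drive i hgi hai r', ⟨hg, haG, h, h1⟩, ?_, ?_⟩
        · simp only [length]; linarith
        · simp only [plainLength]; linarith

lemma exists_isNormal {G : Set (ℝ × ℝ)}
    (hG : ∀ i j a, i ≠ j → a ∈ N.road i → a ∈ N.road j → a ∈ G)
    {S D : ℝ × ℝ} (hS : S ∈ G) (hD : D ∈ G) (r : Route N S D) :
    ∃ r' : Route N S D, r'.IsNormal G ∧ r'.length ≤ r.length ∧
      r'.plainLength ≤ r.plainLength := by
  cases r with
  | arrive a => exact ⟨arrive S, trivial, le_rfl, le_rfl⟩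
  | drive i ha hb rest =>
    simpa [manhattanDist_self] using
      exists_isNormal_of_mem_road hG (drive i ha hb rest) hD i ha S ha hS

/-- Each drive costs at least `δ`, so `n` bounds the number of drives. The next stop lies in the
finite set `B`, and the drive is either plain or charging, hence two images per stop. Counting
values instead of routes makes the labels of the roads irrelevant. -/
lemma finite_values_of_length_le_mul {G B : Set (ℝ × ℝ)} {D : ℝ × ℝ} {L δ : ℝ} (hB : B.Finite)
    (hGB : ∀ a ∈ G, manhattanDist a D ≤ L → a ∈ B)
    (hδ : ∀ a ∈ B, ∀ b ∈ B, a ≠ b → δ ≤ manhattanDist a b) (n : ℕ) (g : ℝ × ℝ) :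
    {v : ℝ × ℝ | ∃ r : Route N g D, r.IsNormal G ∧ r.length ≤ L ∧ r.length ≤ n * δ ∧
      v = (r.length, r.plainLength)}.Finite := by
  induction n generalizing g with
  | zero =>
    refine (Set.finite_singleton ((0 : ℝ), (0 : ℝ))).subset ?_
    rintro v ⟨r, h1, h2, h3, rfl⟩
    cases r with
    | arrive a => simp [length, plainLength]
    | @drive _ b _ i ha hb rest =>
      have := manhattanDist_pos h1.2.2.1
      have := rest.length_nonneg
      simp only [length, Nat.cast_zero, zero_mul] at h3
      linarith
  | succ n ih =>
    refine ((Set.finite_singleton ((0 : ℝ), (0 : ℝ))).union (hB.biUnion fun b _ =>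
      ((ih b).image fun v => (manhattanDist g b + v.1, manhattanDist g b + v.2)).union
        ((ih b).image fun v => (manhattanDist g b + v.1, v.2)))).subset ?_
    rintro v ⟨r, h1, h2, h3, rfl⟩
    cases r with
    | arrive a => left; simp [length, plainLength]
    | @drive _ b _ i ha hb rest =>
      right
      obtain ⟨hg, hbG, hne, hn⟩ := h1
      have hd := (drive i ha hb rest).manhattanDist_le_length
      have hr := rest.manhattanDist_le_length
      have h0 := manhattanDist_nonneg g b
      simp only [length] at h2 h3 hd
      push_cast at h3
      have hbB := hGB b hbG (by linarith)
      have hgb := hδ g (hGB g hg (by linarith)) b hbB hne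
      have hmem : (rest.length, rest.plainLength) ∈ {v : ℝ × ℝ | ∃ r : Route N b D,
          r.IsNormal G ∧ r.length ≤ L ∧ r.length ≤ n * δ ∧ v = (r.length, r.plainLength)} :=
        ⟨rest, hn, by linarith, by linarith, rfl⟩
      refine Set.mem_biUnion hbB ?_
      by_cases hc : N.charging i = true
      · right
        exact ⟨_, hmem, by simp [length, plainLength, hc]⟩
      · left
        exact ⟨_, hmem, by simp [length, plainLength, hc]⟩

lemma finite_values_of_length_le {G : Set (ℝ × ℝ)} {D : ℝ × ℝ} {L : ℝ}
    (hB : {a ∈ G | manhattanDist a D ≤ L}.Finite) (g : ℝ × ℝ) :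
    {v : ℝ × ℝ | ∃ r : Route N g D, r.IsNormal G ∧ r.length ≤ L ∧
      v = (r.length, r.plainLength)}.Finite := by
  set B := {a ∈ G | manhattanDist a D ≤ L}
  obtain ⟨δ, hδ0, hδ⟩ : ∃ δ : ℝ, 0 < δ ∧
      ∀ a ∈ B, ∀ b ∈ B, a ≠ b → δ ≤ manhattanDist a b := by
    have hF : {q ∈ B ×ˢ B | q.1 ≠ q.2}.Finite := (hB.prod hB).subset (Set.sep_subset _ _)
    rcases Set.eq_empty_or_nonempty {q ∈ B ×ˢ B | q.1 ≠ q.2} with h | h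
    · refine ⟨1, one_pos, fun a ha b hb hab => ?_⟩
      have : (a, b) ∈ {q ∈ B ×ˢ B | q.1 ≠ q.2} := ⟨⟨ha, hb⟩, hab⟩
      rw [h] at this
      exact this.elim
    · obtain ⟨q, hq, hmin⟩ := Set.exists_min_image _ (fun q => manhattanDist q.1 q.2) hF h
      exact ⟨_, manhattanDist_pos hq.2, fun a ha b hb hab => hmin (a, b) ⟨⟨ha, hb⟩, hab⟩⟩
  obtain ⟨n, hn⟩ := exists_nat_ge (L / δ)
  rw [div_le_iff₀ hδ0] at hn
  refine (finite_values_of_length_le_mul (N := N) (G := G) (L := L) hB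
    (fun a ha h => ⟨ha, h⟩) hδ n g).subset ?_
  rintro v ⟨r, h1, h2, rfl⟩
  exact ⟨r, h1, h2, h2.trans hn, rfl⟩

/-- In a locally finite network without coinciding roads, two points that are connected at all are
connected by a policy route. -/
theorem exists_isPolicyRoute (hfin : ∀ L : ℝ, {i | |N.offset i| ≤ L}.Finite)
    (hinj : ∀ i j, N.orientation i = N.orientation j → N.offset i = N.offset j → i = j)
    {S D : ℝ × ℝ} (r₀ : Route N S D) : ∃ r : Route N S D, r.IsPolicyRoute := by
  -- The grid `Z ×ˢ Z` contains both end points and every crossing of two distinct roads, and it is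
  -- locally finite.
  set Z : Set ℝ := {S.1, S.2, D.1, D.2} ∪ Set.range N.offset
  set G : Set (ℝ × ℝ) := Z ×ˢ Z
  have hZ : ∀ L : ℝ, {z ∈ Z | |z| ≤ L}.Finite := fun L => by
    refine (((Set.finite_singleton D.2).insert D.1 |>.insert S.2 |>.insert S.1).union
      ((hfin L).image N.offset)).subset ?_
    rintro z ⟨hz | ⟨i, rfl⟩, hzL⟩
    · exact Or.inl hz
    · exact Or.inr ⟨i, hzL, rfl⟩
  have hG : ∀ i j a, i ≠ j → a ∈ N.road i → a ∈ N.road j → a ∈ G := by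
    intro i j a hij hi hj
    rcases hoi : N.orientation i with _ | _ <;> rcases hoj : N.orientation j with _ | _
    · rw [RoadNetwork.mem_road_horizontal hoi] at hi
      rw [RoadNetwork.mem_road_horizontal hoj] at hj
      exact absurd (hinj i j (hoi.trans hoj.symm) (hi.symm.trans hj)) hij
    · rw [RoadNetwork.mem_road_horizontal hoi] at hi
      rw [RoadNetwork.mem_road_vertical hoj] at hj
      exact ⟨Or.inr ⟨j, hj.symm⟩, Or.inr ⟨i, hi.symm⟩⟩
    · rw [RoadNetwork.mem_road_vertical hoi] at hi
      rw [RoadNetwork.mem_road_horizontal hoj] at hj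
      exact ⟨Or.inr ⟨i, hi.symm⟩, Or.inr ⟨j, hj.symm⟩⟩
    · rw [RoadNetwork.mem_road_vertical hoi] at hi
      rw [RoadNetwork.mem_road_vertical hoj] at hj
      exact absurd (hinj i j (hoi.trans hoj.symm) (hi.symm.trans hj)) hij
  have hS : S ∈ G := ⟨Or.inl (by simp), Or.inl (by simp)⟩
  have hD : D ∈ G := ⟨Or.inl (by simp), Or.inl (by simp)⟩
  have hB : {a ∈ G | manhattanDist a D ≤ r₀.length}.Finite := by
    refine ((hZ (|D.1| + r₀.length)).prod (hZ (|D.2| + r₀.length))).subset ?_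
    rintro a ⟨⟨h1, h2⟩, h3⟩
    unfold manhattanDist at h3
    have e1 := abs_sub_abs_le_abs_sub a.1 D.1
    have e2 := abs_sub_abs_le_abs_sub a.2 D.2
    have e3 := abs_nonneg (a.1 - D.1)
    have e4 := abs_nonneg (a.2 - D.2)
    exact ⟨⟨h1, by linarith⟩, ⟨h2, by linarith⟩⟩
  set T := {v : ℝ × ℝ | ∃ r : Route N S D, r.IsNormal G ∧ r.length ≤ r₀.length ∧
      v = (r.length, r.plainLength)} with hT
  have hTfin : T.Finite := finite_values_of_length_le hB S
  obtain ⟨r₁, hr₁, hr₁', -⟩ := exists_isNormal hG hS hD r₀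
  -- Lexicographic minimisation over the finite set of values: length, then plain length.
  obtain ⟨u, ⟨r₂, hr₂, hr₂', rfl⟩, hu⟩ :=
    Set.exists_min_image T Prod.fst hTfin ⟨_, r₁, hr₁, hr₁', rfl⟩
  obtain ⟨w, ⟨⟨r, hr, hr', rfl⟩, hwu⟩, hw⟩ :=
    Set.exists_min_image {v ∈ T | v.1 = r₂.length} Prod.snd (hTfin.subset (Set.sep_subset _ _))
      ⟨_, ⟨r₂, hr₂, hr₂', rfl⟩, rfl⟩
  simp only at hwu hu hw
  have hshort : r.IsShortest := fun r' => by
    obtain ⟨s, hs, hs', -⟩ := exists_isNormal hG hS hD r'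
    rcases le_total r'.length r₀.length with h | h
    · have := hu _ ⟨s, hs, hs'.trans h, rfl⟩
      simp only at this
      linarith
    · linarith
  refine ⟨r, hshort, fun r' hr'' => ?_⟩
  obtain ⟨s, hs, hs', hs''⟩ := exists_isNormal hG hS hD r'
  have e1 := hshort s
  have e2 := hr'' r
  have e3 := hw _ ⟨⟨s, hs, by linarith, rfl⟩, show s.length = r₂.length by linarith⟩
  simp only at e3
  have e4 := r.plainLength_add_chargingLength
  have e5 := r'.plainLength_add_chargingLength
  linarith

/-! ## Routes as short as the distance of their end points -/

lemma abs_add_abs_le_iff_mem_uIcc {a b c : ℝ} : |a - b| + |b - c| ≤ |a - c| ↔ b ∈ Set.uIcc a c := by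
  rw [Set.mem_uIcc]
  constructor
  · intro h
    rcases abs_cases (a - b) with h1 | h1 <;> rcases abs_cases (b - c) with h2 | h2 <;>
      rcases abs_cases (a - c) with h3 | h3 <;>
      first
        | (left; constructor <;> linarith)
        | (right; constructor <;> linarith)
  · rintro (⟨h1, h2⟩ | ⟨h1, h2⟩)
    · rw [abs_of_nonpos (by linarith), abs_of_nonpos (by linarith), abs_of_nonpos (by linarith)]
      linarith
    · rw [abs_of_nonneg (by linarith), abs_of_nonneg (by linarith), abs_of_nonneg (by linarith)]
      linarith

/-- Equality in the triangle inequality holds in each coordinate separately. Direct routes are thus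
monotone staircases, and what remains after a drive is direct within a smaller rectangle; this
drives the inductions below. -/
lemma direct_rest {a b D : ℝ × ℝ} (rest : Route N b D)
    (h : manhattanDist a b + rest.length ≤ manhattanDist a D) :
    rest.length ≤ manhattanDist b D ∧ b.1 ∈ Set.uIcc a.1 D.1 ∧ b.2 ∈ Set.uIcc a.2 D.2 := by
  have h1 := manhattanDist_triangle a b D
  have h2 := rest.manhattanDist_le_length
  have h3 := abs_sub_le a.1 b.1 D.1
  have h4 := abs_sub_le a.2 b.2 D.2
  refine ⟨by linarith, abs_add_abs_le_iff_mem_uIcc.1 ?_, abs_add_abs_le_iff_mem_uIcc.1 ?_⟩ <;>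
  · unfold manhattanDist at *
    linarith

/-- A direct route that meets no charging road between its end points. -/
lemma chargingLength_eq_zero_of_forall_notMem {a D : ℝ × ℝ} (r : Route N a D)
    (hr : r.length ≤ manhattanDist a D)
    (hh : ∀ i, N.orientation i = .horizontal → N.charging i = true →
      N.offset i ∉ Set.uIcc a.2 D.2)
    (hv : ∀ i, N.orientation i = .vertical → N.charging i = true →
      N.offset i ∉ Set.uIcc a.1 D.1) : r.chargingLength = 0 := by
  induction r with
  | arrive a => rfl
  | @drive a b c i ha hb rest ih =>
    simp only [length] at hr
    obtain ⟨h1, h2, h3⟩ := direct_rest rest hr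
    have hi : N.charging i ≠ true := by
      intro hi
      rcases ho : N.orientation i with _ | _
      · rw [RoadNetwork.mem_road_horizontal ho] at ha
        exact hh i ho hi (ha ▸ Set.left_mem_uIcc)
      · rw [RoadNetwork.mem_road_vertical ho] at ha
        exact hv i ho hi (ha ▸ Set.left_mem_uIcc)
    have := ih h1
      (fun i ho hi h => hh i ho hi (Set.uIcc_subset_uIcc_right h3 h))
      (fun i ho hi h => hv i ho hi (Set.uIcc_subset_uIcc_right h2 h))
    simp [chargingLength, hi, this]

/-- With no horizontal road at the available heights every drive is vertical, so the abscissa never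
changes. -/
lemma fst_eq_of_forall_horizontal_notMem {a D : ℝ × ℝ} (r : Route N a D)
    (hr : r.length ≤ manhattanDist a D)
    (hh : ∀ i, N.orientation i = .horizontal → N.offset i ∉ Set.uIcc a.2 D.2) : a.1 = D.1 := by
  induction r with
  | arrive a => rfl
  | @drive a b c i ha hb rest ih =>
    simp only [length] at hr
    obtain ⟨h1, h2, h3⟩ := direct_rest rest hr
    rcases ho : N.orientation i with _ | _
    · rw [RoadNetwork.mem_road_horizontal ho] at ha
      exact absurd (ha ▸ Set.left_mem_uIcc) (hh i ho)
    · rw [RoadNetwork.mem_road_vertical ho] at ha hb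
      rw [ha, ← hb]
      exact ih h1 fun i ho h => hh i ho (Set.uIcc_subset_uIcc_right h3 h)

/-- The rectangle degenerates to a vertical segment: a horizontal drive has length zero, and a
vertical one is on a road through `D`. -/
lemma chargingLength_eq_zero_of_fst_eq {a D : ℝ × ℝ} (r : Route N a D)
    (hr : r.length ≤ manhattanDist a D) (haD : a.1 = D.1)
    (hv : ∀ i, N.orientation i = .vertical → N.offset i = D.1 → N.charging i ≠ true) :
    r.chargingLength = 0 := by
  induction r with
  | arrive a => rfl
  | @drive a b c i ha hb rest ih =>
    simp only [length] at hr
    obtain ⟨h1, h2, h3⟩ := direct_rest rest hr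
    rw [haD, Set.uIcc_self, Set.mem_singleton_iff] at h2
    have := ih h1 h2 hv
    rcases ho : N.orientation i with _ | _
    · rw [RoadNetwork.mem_road_horizontal ho] at ha hb
      have : manhattanDist a b = 0 := by simp [manhattanDist, ha, hb, haD, h2]
      simp [chargingLength, *]
    · rw [RoadNetwork.mem_road_vertical ho] at ha hb
      have := hv i ho (by rw [← ha, haD])
      simp [chargingLength, *]

/-- A direct route whose start lies at the only height at which one can drive horizontally. -/
lemma chargingLength_eq_zero_of_horizontal_unique {a D : ℝ × ℝ} (r : Route N a D)
    (hr : r.length ≤ manhattanDist a D)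
    (hh : ∀ i, N.orientation i = .horizontal → N.offset i ∈ Set.uIcc a.2 D.2 →
      N.offset i = a.2 ∧ N.charging i ≠ true)
    (hv : ∀ i, N.orientation i = .vertical → N.offset i = D.1 → N.charging i ≠ true) :
    r.chargingLength = 0 := by
  induction r with
  | arrive a => rfl
  | @drive a b c i ha hb rest ih =>
    simp only [length] at hr
    obtain ⟨h1, h2, h3⟩ := direct_rest rest hr
    rcases ho : N.orientation i with _ | _
    · rw [RoadNetwork.mem_road_horizontal ho] at ha hb
      have hi := (hh i ho (ha ▸ Set.left_mem_uIcc)).2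
      have := ih h1 (by rw [hb, ← ha]; exact hh) hv
      simp [chargingLength, hi, this]
    · rw [RoadNetwork.mem_road_vertical ho] at ha hb
      by_cases hab : b.2 = a.2
      · have hd : manhattanDist a b = 0 := by simp [manhattanDist, ha, hb, hab]
        have := ih h1 (by rw [hab]; exact hh) hv
        simp [chargingLength, hd, this]
      -- A direct route never returns to the height it has left, and no other height has a
      -- horizontal road. So the abscissa of the destination must already be reached.
      · have hb1 : b.1 = c.1 := by
          refine fst_eq_of_forall_horizontal_notMem rest h1 fun j hj hjm => hab ?_
          have hja := (hh j hj (Set.uIcc_subset_uIcc_right h3 hjm)).1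
          rw [hja] at hjm
          rw [Set.mem_uIcc] at hjm h3
          rcases hjm with ⟨_, _⟩ | ⟨_, _⟩ <;> rcases h3 with ⟨_, _⟩ | ⟨_, _⟩ <;> linarith
        have hi := hv i ho (by rw [← hb, hb1])
        have := chargingLength_eq_zero_of_fst_eq rest h1 hb1 hv
        simp [chargingLength, hi, this]

/-- A direct route to a destination on the only road on which one can drive vertically. -/
lemma chargingLength_eq_zero_of_vertical_unique {a D : ℝ × ℝ} (r : Route N a D)
    (hr : r.length ≤ manhattanDist a D)
    (hh : ∀ i, N.orientation i = .horizontal → N.offset i = a.2 → N.charging i ≠ true)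
    (hv : ∀ i, N.orientation i = .vertical → N.offset i ∈ Set.uIcc a.1 D.1 →
      N.offset i = D.1 ∧ N.charging i ≠ true) : r.chargingLength = 0 := by
  induction r with
  | arrive a => rfl
  | @drive a b c i ha hb rest ih =>
    have hr' := hr
    simp only [length] at hr
    obtain ⟨h1, h2, h3⟩ := direct_rest rest hr
    rcases ho : N.orientation i with _ | _
    · have ha' := ha
      have hb' := hb
      rw [RoadNetwork.mem_road_horizontal ho] at ha' hb'
      have hi := hh i ho ha'.symm
      have := ih h1 (by rw [hb', ← ha']; exact hh)
        fun j hj hjm => hv j hj (Set.uIcc_subset_uIcc_right h2 hjm)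
      simp [chargingLength, hi, this]
    -- Any vertical drive takes place at the abscissa of the destination, so the whole remaining
    -- route, this drive included, is on that line.
    · have ha' := ha
      rw [RoadNetwork.mem_road_vertical ho] at ha'
      have hi := (hv i ho (ha' ▸ Set.left_mem_uIcc)).1
      exact chargingLength_eq_zero_of_fst_eq _ hr' (by rw [ha', hi])
        fun j hj hjc => (hv j hj (hjc ▸ Set.right_mem_uIcc)).2

/-! ## Routes between two vertical roads -/

/-- Here `y` is the height at which the trip began, fixed during the induction, and `|y - a.2|`
credits the vertical distance already covered. The first horizontal drive takes place at some road
height, whose detour is at least `m`. -/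
lemma le_length_of_forall_horizontal {a D : ℝ × ℝ} (r : Route N a D) {y m : ℝ}
    (haD : a.1 ≠ D.1)
    (hm : ∀ i, N.orientation i = .horizontal → m ≤ |y - N.offset i| + |N.offset i - D.2|) :
    |a.1 - D.1| + m - |y - a.2| ≤ r.length := by
  induction r with
  | arrive a => exact absurd rfl haD
  | @drive a b c i ha hb rest ih =>
    have hl := (drive i ha hb rest).manhattanDist_le_length
    rcases ho : N.orientation i with _ | _
    · rw [RoadNetwork.mem_road_horizontal ho] at ha hb
      have := hm i ho
      rw [← ha] at this
      unfold manhattanDist at hl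
      linarith
    · rw [RoadNetwork.mem_road_vertical ho] at ha hb
      have hab : a.1 = b.1 := by rw [ha, hb]
      have := ih (hab ▸ haD) hm
      have h1 := abs_sub_le y a.2 b.2
      simp only [length, manhattanDist, hab, sub_self, abs_zero, zero_add]
      linarith

/-- The rigidity case of the previous bound: the first horizontal drive must be at height `z`, and
from there the route is direct with `z` as the only usable height. -/
lemma chargingLength_eq_zero_of_unique_detour {a D : ℝ × ℝ} (r : Route N a D) {y z : ℝ}
    (haD : a.1 ≠ D.1)
    (hr : r.length ≤ |a.1 - D.1| + (|y - z| + |z - D.2|) - |y - a.2|)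
    (hh : ∀ i, N.orientation i = .horizontal → (N.offset i = z ∧ N.charging i ≠ true) ∨
      |y - z| + |z - D.2| < |y - N.offset i| + |N.offset i - D.2|)
    (hva : ∀ i, N.orientation i = .vertical → N.offset i = a.1 → N.charging i ≠ true)
    (hvD : ∀ i, N.orientation i = .vertical → N.offset i = D.1 → N.charging i ≠ true) :
    r.chargingLength = 0 := by
  induction r with
  | arrive a => rfl
  | @drive a b c i ha hb rest ih =>
    have hl := (drive i ha hb rest).manhattanDist_le_length
    rcases ho : N.orientation i with _ | _
    · have ha' := ha
      rw [RoadNetwork.mem_road_horizontal ho] at ha'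
      have haz : a.2 = z := by
        rcases hh i ho with h | h
        · rw [ha', h.1]
        · rw [← ha'] at h
          unfold manhattanDist at hl
          linarith
      refine chargingLength_eq_zero_of_horizontal_unique _ ?_ (fun j hj hjm => ?_) hvD
      · unfold manhattanDist
        rw [haz] at hr ⊢
        linarith
      · rw [haz] at hjm ⊢
        rcases hh j hj with h | h
        · exact h
        -- A road between `z` and the destination height would have a detour no longer than that of
        -- `z`.
        · have h1 := abs_add_abs_le_iff_mem_uIcc.2 hjm
          have h2 := abs_sub_le y z (N.offset j)
          linarith
    · rw [RoadNetwork.mem_road_vertical ho] at ha hb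
      have hab : a.1 = b.1 := by rw [ha, hb]
      have hi := hva i ho ha.symm
      have h1 := abs_sub_le y a.2 b.2
      simp only [length, manhattanDist, hab, sub_self, abs_zero, zero_add] at hr
      have := ih (hab ▸ haD) (by linarith) hh (hab ▸ hva) hvD
      simp [chargingLength, hi, this]

lemma IsPolicyRoute.chargingLength_pos {S D : ℝ × ℝ} {r r' : Route N S D} (hr : r.IsPolicyRoute)
    (hr' : r'.IsShortest) (h : 0 < r'.chargingLength) : 0 < r.chargingLength :=
  h.trans_le (hr.2 r' hr')

end Route

/-! ## The two kinds of trip networks -/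

/-- With the placement fixed, orientations and offsets reduce definitionally, so explicit routes
need only `rfl`. -/
def parallelNetwork (h v : ℕ → ℝ) (c : RoadIndex → Bool) (S D : ℝ × ℝ) :
    RoadNetwork RoadIndex where
  orientation
    | .source => .vertical
    | .destination => .vertical
    | .horizontal _ => .horizontal
    | .vertical _ => .vertical
  offset
    | .source => S.1
    | .destination => D.1
    | .horizontal k => h k
    | .vertical k => v k
  charging := c

def perpendicularNetwork (h v : ℕ → ℝ) (c : RoadIndex → Bool) (S D : ℝ × ℝ) :
    RoadNetwork RoadIndex where
  orientation
    | .source => .horizontal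
    | .destination => .vertical
    | .horizontal _ => .horizontal
    | .vertical _ => .vertical
  offset
    | .source => S.2
    | .destination => D.1
    | .horizontal k => h k
    | .vertical k => v k
  charging := c

/-- Roads in general position with respect to the end points `S` and `D` of a trip. -/
structure IsGeneric (h v : ℕ → ℝ) (S D : ℝ × ℝ) : Prop where
  hor_injective : Function.Injective h
  ver_injective : Function.Injective v
  hor_ne_source : ∀ k, h k ≠ S.2
  hor_ne_destination : ∀ k, h k ≠ D.2
  ver_ne_source : ∀ k, v k ≠ S.1
  ver_ne_destination : ∀ k, v k ≠ D.1
  hor_finite : ∀ L : ℝ, {k | |h k| ≤ L}.Finite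
  ver_finite : ∀ L : ℝ, {k | |v k| ≤ L}.Finite
  -- Mirror images about the midpoint are the only way for distinct heights outside the segment to
  -- tie in `detour`.
  hor_add_ne : ∀ j k, j ≠ k → h j + h k ≠ S.2 + D.2

/-- The vertical distance that is driven from height `a` to height `b` by way of height `y`. -/
def detour (a b y : ℝ) : ℝ := |a - y| + |y - b|

lemma abs_sub_le_detour (a b y : ℝ) : |a - b| ≤ detour a b y := abs_sub_le a y b

lemma detour_eq_of_mem_uIcc {a b y : ℝ} (h : y ∈ Set.uIcc a b) : detour a b y = |a - b| :=
  le_antisymm (Route.abs_add_abs_le_iff_mem_uIcc.2 h) (abs_sub_le_detour a b y)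

lemma mem_uIcc_of_detour_le {a b y : ℝ} (h : detour a b y ≤ |a - b|) : y ∈ Set.uIcc a b :=
  Route.abs_add_abs_le_iff_mem_uIcc.1 h

lemma mem_uIoo_of_mem_uIcc {a b y : ℝ} (h : y ∈ Set.uIcc a b) (ha : y ≠ a) (hb : y ≠ b) :
    y ∈ Set.uIoo a b := by
  rcases le_total a b with hab | hab
  · rw [Set.uIcc_of_le hab] at h
    rw [Set.uIoo_of_le hab]
    exact ⟨lt_of_le_of_ne h.1 ha.symm, lt_of_le_of_ne h.2 hb⟩
  · rw [Set.uIcc_of_ge hab] at h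
    rw [Set.uIoo_of_ge hab]
    exact ⟨lt_of_le_of_ne h.1 hb.symm, lt_of_le_of_ne h.2 ha⟩

lemma mem_uIcc_of_mem_uIoo {a b y : ℝ} (h : y ∈ Set.uIoo a b) : y ∈ Set.uIcc a b :=
  Set.Ioo_subset_Icc_self h

/-- Heights with the same detour agree, mirror each other, or lie both in between. -/
lemma mem_uIcc_of_detour_eq {a b y z : ℝ} (h : detour a b y = detour a b z) (hyz : y ≠ z)
    (hadd : y + z ≠ a + b) : y ∈ Set.uIcc a b ∧ z ∈ Set.uIcc a b := by
  suffices detour a b y ≤ |a - b| from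
    ⟨mem_uIcc_of_detour_le this, mem_uIcc_of_detour_le (h ▸ this)⟩
  unfold detour at *
  by_contra! hlt
  rcases abs_cases (a - y) with h1 | h1 <;> rcases abs_cases (y - b) with h2 | h2 <;>
    rcases abs_cases (a - z) with h3 | h3 <;> rcases abs_cases (z - b) with h4 | h4 <;>
    rcases abs_cases (a - b) with h5 | h5 <;>
    first
      | linarith
      | exact hyz (by linarith)
      | exact hadd (by linarith)

/-- Sublevel sets of `detour` are bounded, so only finitely many roads compete with road `0`. -/
lemma exists_forall_detour_le {h : ℕ → ℝ} (hfin : ∀ L : ℝ, {k | |h k| ≤ L}.Finite) (a b : ℝ) :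
    ∃ k, ∀ j, detour a b (h k) ≤ detour a b (h j) := by
  have hF : {k | detour a b (h k) ≤ detour a b (h 0)}.Finite := by
    refine (hfin (|a| + detour a b (h 0))).subset fun k hk => ?_
    have h1 := abs_sub_abs_le_abs_sub (h k) a
    have h2 := abs_nonneg (h k - b)
    rw [abs_sub_comm] at h1
    simp only [Set.mem_ofPred_eq] at hk ⊢
    unfold detour at hk ⊢
    linarith
  obtain ⟨k, hk, hmin⟩ := Set.exists_min_image _ (fun k => detour a b (h k)) hF
    ⟨0, le_refl (detour a b (h 0))⟩
  refine ⟨k, fun j => ?_⟩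
  rcases le_total (detour a b (h j)) (detour a b (h 0)) with hj | hj
  · exact hmin j hj
  · exact le_trans hk hj

section

variable {h v : ℕ → ℝ} {c : RoadIndex → Bool} {S D : ℝ × ℝ}

/-! ### Parallel source and destination roads -/

lemma exists_parallel_route (k : ℕ) :
    ∃ r : Route (parallelNetwork h v c S D) S D,
      r.length = |S.1 - D.1| + detour S.2 D.2 (h k) ∧
      r.chargingLength = (if c .source = true then |S.2 - h k| else 0) +
        (if c (.horizontal k) = true then |S.1 - D.1| else 0) +
        (if c .destination = true then |h k - D.2| else 0) := by
  refine ⟨.drive (b := (S.1, h k)) .source rfl rfl (.drive (b := (D.1, h k)) (.horizontal k) rfl rfl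
    (.drive .destination rfl rfl (.arrive D))), ?_, ?_⟩
  · simp only [Route.length, manhattanDist, detour]
    simp
    ring
  · simp only [Route.chargingLength, manhattanDist, parallelNetwork]
    simp
    ring

/-- Two horizontal roads met in the order `k`, `l` allow a direct staircase that uses the vertical
road `m` for the gap between them. -/
lemma exists_parallel_route_between {k l m : ℕ} (hk : h k ∈ Set.uIcc S.2 D.2)
    (hl : h l ∈ Set.uIcc (h k) D.2) (hm : v m ∈ Set.uIcc S.1 D.1) (hc : c (.vertical m) = true) :
    ∃ r : Route (parallelNetwork h v c S D) S D,
      r.length = |S.1 - D.1| + |S.2 - D.2| ∧ |h k - h l| ≤ r.chargingLength := by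
  refine ⟨.drive (b := (S.1, h k)) .source rfl rfl (.drive (b := (v m, h k)) (.horizontal k) rfl rfl
    (.drive (b := (v m, h l)) (.vertical m) rfl rfl (.drive (b := (D.1, h l)) (.horizontal l) rfl rfl
    (.drive .destination rfl rfl (.arrive D))))), ?_, ?_⟩
  · have h1 := detour_eq_of_mem_uIcc hk
    have h2 := detour_eq_of_mem_uIcc hl
    have h3 := detour_eq_of_mem_uIcc hm
    unfold detour at h1 h2 h3
    simp only [Route.length, manhattanDist]
    simp
    linarith
  · simp only [Route.chargingLength, manhattanDist, parallelNetwork, hc, if_true]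
    have h1 : ∀ (b : Bool) (x : ℝ), 0 ≤ x → 0 ≤ (if b = true then x else 0) := by
      intro b x hx; split_ifs <;> simp [hx]
    have h2 := h1 (c .source) |S.2 - h k| (by positivity)
    have h3 := h1 (c (.horizontal k)) |S.1 - v m| (by positivity)
    have h4 := h1 (c (.horizontal l)) |v m - D.1| (by positivity)
    have h5 := h1 (c .destination) |h l - D.2| (by positivity)
    simp only [sub_self, abs_zero, zero_add, add_zero]
    linarith

lemma isShortest_parallel_of_length_le (hSD : S.1 ≠ D.1)
    {r : Route (parallelNetwork h v c S D) S D} {k : ℕ}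
    (hk : ∀ j, detour S.2 D.2 (h k) ≤ detour S.2 D.2 (h j))
    (hr : r.length ≤ |S.1 - D.1| + detour S.2 D.2 (h k)) : r.IsShortest := by
  intro r'
  have := r'.le_length_of_forall_horizontal (y := S.2) (m := detour S.2 D.2 (h k)) hSD
    (by rintro (_ | _ | j | j) hj <;> first | exact hk j | cases hj)
  simp only [sub_self, abs_zero, sub_zero] at this
  linarith

lemma IsGeneric.exists_isPolicyRoute_parallel (hg : IsGeneric h v S D) (hSD : S.1 ≠ D.1) :
    ∃ r : Route (parallelNetwork h v c S D) S D, r.IsPolicyRoute := by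
  obtain ⟨r₀, -⟩ := exists_parallel_route (h := h) (v := v) (c := c) (S := S) (D := D) 0
  refine Route.exists_isPolicyRoute (fun L => ?_) ?_ r₀
  · refine (((Set.finite_singleton RoadIndex.source).insert RoadIndex.destination).union
      (((hg.hor_finite L).image RoadIndex.horizontal).union
        ((hg.ver_finite L).image RoadIndex.vertical))).subset ?_
    rintro (_ | _ | k | k) hk
    · simp
    · simp
    · exact Or.inr (Or.inl ⟨k, hk, rfl⟩)
    · exact Or.inr (Or.inr ⟨k, hk, rfl⟩)
  · rintro (_ | _ | k | k) (_ | _ | l | l) ho he <;>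
      first
        | rfl
        | exact absurd he hSD
        | exact absurd he.symm hSD
        | exact absurd he (hg.ver_ne_source _)
        | exact absurd he.symm (hg.ver_ne_source _)
        | exact absurd he (hg.ver_ne_destination _)
        | exact absurd he.symm (hg.ver_ne_destination _)
        | exact congrArg _ (hg.hor_injective he)
        | exact congrArg _ (hg.ver_injective he)
        | cases ho

/-- When a trip between parallel roads does without charging: either a single horizontal road
gives the shortest detour and is not charging, or there is a choice of horizontal roads, and no road
in between is charging. -/
def ParallelUncharged (h v : ℕ → ℝ) (c : RoadIndex → Bool) (S D : ℝ × ℝ) : Prop :=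
  (∃ k, (∀ j, j ≠ k → detour S.2 D.2 (h k) < detour S.2 D.2 (h j)) ∧
    c (.horizontal k) = false) ∨
  ((∃ k l, k ≠ l ∧ h k ∈ Set.uIoo S.2 D.2 ∧ h l ∈ Set.uIoo S.2 D.2) ∧
    (∀ k, h k ∈ Set.uIoo S.2 D.2 → c (.horizontal k) = false) ∧
    ∀ k, v k ∈ Set.uIoo S.1 D.1 → c (.vertical k) = false)

/-- A unique best detour forces the crossing. In the other case a horizontal road in between makes
all shortest routes direct, confining them to a rectangle without charging roads. -/
lemma IsGeneric.chargingLength_eq_zero_parallel (hg : IsGeneric h v S D) (hSD : S.1 ≠ D.1)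
    (hcS : c .source = false) (hcD : c .destination = false)
    (hW : ParallelUncharged h v c S D) (r : Route (parallelNetwork h v c S D) S D)
    (hr : r.IsShortest) : r.chargingLength = 0 := by
  rcases hW with ⟨k, hk, hck⟩ | ⟨⟨k, l, -, hk, -⟩, hch, hcv⟩
  · obtain ⟨r₀, hr₀, -⟩ := exists_parallel_route (h := h) (v := v) (c := c) (S := S) (D := D) k
    have hlen := hr r₀
    refine r.chargingLength_eq_zero_of_unique_detour (y := S.2) (z := h k) hSD ?_ ?_ ?_ ?_
    · rw [hr₀] at hlen
      unfold detour at hlen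
      simpa using hlen
    · rintro (_ | _ | j | j) hj
      · cases hj
      · cases hj
      · by_cases hjk : j = k
        · subst hjk
          exact Or.inl ⟨rfl, by simp [parallelNetwork, hck]⟩
        · exact Or.inr (hk j hjk)
      · cases hj
    · rintro (_ | _ | j | j) hj hjS
      · simp [parallelNetwork, hcS]
      · exact absurd hjS.symm hSD
      · cases hj
      · exact absurd hjS (hg.ver_ne_source j)
    · rintro (_ | _ | j | j) hj hjS
      · exact absurd hjS hSD
      · simp [parallelNetwork, hcD]
      · cases hj
      · exact absurd hjS (hg.ver_ne_destination j)
  · obtain ⟨r₀, hr₀, -⟩ := exists_parallel_route (h := h) (v := v) (c := c) (S := S) (D := D) k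
    have hlen := hr r₀
    rw [hr₀, detour_eq_of_mem_uIcc (mem_uIcc_of_mem_uIoo hk)] at hlen
    refine r.chargingLength_eq_zero_of_forall_notMem hlen ?_ ?_
    · rintro (_ | _ | j | j) hj hjc hjm
      · cases hj
      · cases hj
      · have := hch j (mem_uIoo_of_mem_uIcc hjm (hg.hor_ne_source j) (hg.hor_ne_destination j))
        simp [parallelNetwork, this] at hjc
      · cases hj
    · rintro (_ | _ | j | j) hj hjc hjm
      · simp [parallelNetwork, hcS] at hjc
      · simp [parallelNetwork, hcD] at hjc
      · cases hj
      · have := hcv j (mem_uIoo_of_mem_uIcc hjm (hg.ver_ne_source j) (hg.ver_ne_destination j))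
        simp [parallelNetwork, this] at hjc

/-- If neither the end roads nor a best crossing `k` charge, failure of the first alternative yields
a tie, hence two roads in between. Then every horizontal road in between is a best crossing, and a
vertical one in between can be used for the gap. -/
lemma IsGeneric.exists_chargingLength_pos_parallel (hg : IsGeneric h v S D) (hSD : S.1 ≠ D.1)
    (hW : ¬(c .source = false ∧ c .destination = false ∧ ParallelUncharged h v c S D)) :
    ∃ r : Route (parallelNetwork h v c S D) S D, r.IsShortest ∧ 0 < r.chargingLength := by
  have hvia : ∀ k, (∀ j, detour S.2 D.2 (h k) ≤ detour S.2 D.2 (h j)) →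
      (c .source = true ∨ c .destination = true ∨ c (.horizontal k) = true) →
      ∃ r : Route (parallelNetwork h v c S D) S D, r.IsShortest ∧ 0 < r.chargingLength := by
    intro k hk hck
    obtain ⟨r, hr, hrc⟩ := exists_parallel_route (h := h) (v := v) (c := c) (S := S) (D := D) k
    refine ⟨r, isShortest_parallel_of_length_le hSD hk hr.le, ?_⟩
    have h1 : 0 < |S.1 - D.1| := abs_pos.2 (sub_ne_zero.2 hSD)
    have h2 : 0 < |S.2 - h k| := abs_pos.2 (sub_ne_zero.2 (hg.hor_ne_source k).symm)
    have h3 : 0 < |h k - D.2| := abs_pos.2 (sub_ne_zero.2 (hg.hor_ne_destination k))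
    rw [hrc]
    rcases hck with hck | hck | hck <;> rw [if_pos hck] <;> split_ifs <;> linarith
  obtain ⟨k, hk⟩ := exists_forall_detour_le hg.hor_finite S.2 D.2
  by_cases hcS : c .source = true
  · exact hvia k hk (Or.inl hcS)
  by_cases hcD : c .destination = true
  · exact hvia k hk (Or.inr (Or.inl hcD))
  by_cases hck : c (.horizontal k) = true
  · exact hvia k hk (Or.inr (Or.inr hck))
  simp only [Bool.not_eq_true] at hcS hcD hck
  have hW' : ¬ParallelUncharged h v c S D := fun h' => hW ⟨hcS, hcD, h'⟩
  unfold ParallelUncharged at hW'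
  push Not at hW'
  obtain ⟨hW1, hW2⟩ := hW'
  obtain ⟨l, hlk, hl⟩ : ∃ l, l ≠ k ∧ detour S.2 D.2 (h l) ≤ detour S.2 D.2 (h k) := by
    by_contra! hcon
    exact hW1 k hcon hck
  have heq := le_antisymm hl (hk l)
  obtain ⟨hlm, hkm⟩ := mem_uIcc_of_detour_eq heq (fun e => hlk (hg.hor_injective e))
    (hg.hor_add_ne l k hlk)
  have hkm' := mem_uIoo_of_mem_uIcc hkm (hg.hor_ne_source k) (hg.hor_ne_destination k)
  have hlm' := mem_uIoo_of_mem_uIcc hlm (hg.hor_ne_source l) (hg.hor_ne_destination l)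
  by_cases hch : ∃ j, h j ∈ Set.uIoo S.2 D.2 ∧ c (.horizontal j) = true
  · obtain ⟨j, hj, hcj⟩ := hch
    refine hvia j (fun i => ?_) (Or.inr (Or.inr hcj))
    rw [detour_eq_of_mem_uIcc (mem_uIcc_of_mem_uIoo hj)]
    exact abs_sub_le_detour _ _ _
  push Not at hch
  obtain ⟨m, hm, hcm⟩ := hW2 ⟨k, l, hlk.symm, hkm', hlm'⟩ (by simpa using hch)
  have hcm : c (.vertical m) = true := by simpa using hcm
  have hpos : 0 < |h k - h l| :=
    abs_pos.2 (sub_ne_zero.2 fun e => hlk (hg.hor_injective e.symm))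
  have hmin : detour S.2 D.2 (h k) = |S.2 - D.2| := detour_eq_of_mem_uIcc hkm
  -- One of the two roads is met first on the way from `S` to `D`.
  have hord : h l ∈ Set.uIcc (h k) D.2 ∨ h k ∈ Set.uIcc (h l) D.2 := by
    simp only [Set.mem_uIcc] at *
    rcases le_total (h k) (h l) with h1 | h1 <;> rcases hlm with h2 | h2 <;>
      rcases hkm with h3 | h3 <;> grind
  rcases hord with hord | hord
  · obtain ⟨r, hr, hrc⟩ := exists_parallel_route_between (c := c) hkm hord
      (mem_uIcc_of_mem_uIoo hm) hcm
    exact ⟨r, isShortest_parallel_of_length_le hSD hk (by rw [hr, hmin]), hpos.trans_le hrc⟩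
  · obtain ⟨r, hr, hrc⟩ := exists_parallel_route_between (c := c) hlm hord
      (mem_uIcc_of_mem_uIoo hm) hcm
    rw [abs_sub_comm] at hrc
    exact ⟨r, isShortest_parallel_of_length_le hSD hk (by rw [hr, hmin]), hpos.trans_le hrc⟩

/-! ### Perpendicular source and destination roads -/

lemma isShortest_of_length_le {ι : Type*} {N : RoadNetwork ι} {r : Route N S D}
    (hr : r.length ≤ manhattanDist S D) : r.IsShortest :=
  fun r' => hr.trans r'.manhattanDist_le_length

lemma exists_perpendicular_route :
    ∃ r : Route (perpendicularNetwork h v c S D) S D, r.length = manhattanDist S D ∧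
      r.chargingLength = (if c .source = true then |S.1 - D.1| else 0) +
        (if c .destination = true then |S.2 - D.2| else 0) := by
  refine ⟨.drive (b := (D.1, S.2)) .source rfl rfl (.drive .destination rfl rfl (.arrive D)),
    ?_, ?_⟩
  · simp [Route.length, manhattanDist]
  · simp [Route.chargingLength, manhattanDist, perpendicularNetwork]

lemma exists_perpendicular_route_between {k m : ℕ} (hk : h k ∈ Set.uIcc S.2 D.2)
    (hm : v m ∈ Set.uIcc S.1 D.1) :
    ∃ r : Route (perpendicularNetwork h v c S D) S D, r.length = manhattanDist S D ∧
      (if c (.vertical m) = true then |S.2 - h k| else 0) +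
        (if c (.horizontal k) = true then |v m - D.1| else 0) ≤ r.chargingLength := by
  refine ⟨.drive (b := (v m, S.2)) .source rfl rfl (.drive (b := (v m, h k)) (.vertical m) rfl rfl
    (.drive (b := (D.1, h k)) (.horizontal k) rfl rfl (.drive .destination rfl rfl (.arrive D)))),
    ?_, ?_⟩
  · have h1 := detour_eq_of_mem_uIcc hk
    have h2 := detour_eq_of_mem_uIcc hm
    unfold detour at h1 h2
    simp only [Route.length, manhattanDist]
    simp
    linarith
  · have h1 : ∀ (b : Bool) (x : ℝ), 0 ≤ x → 0 ≤ (if b = true then x else 0) := by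
      intro b x hx; split_ifs <;> simp [hx]
    have h2 := h1 (c .source) |S.1 - v m| (by positivity)
    have h3 := h1 (c .destination) |h k - D.2| (by positivity)
    simp only [Route.chargingLength, manhattanDist, perpendicularNetwork, sub_self, abs_zero,
      zero_add, add_zero]
    linarith

lemma IsGeneric.exists_isPolicyRoute_perpendicular (hg : IsGeneric h v S D) :
    ∃ r : Route (perpendicularNetwork h v c S D) S D, r.IsPolicyRoute := by
  obtain ⟨r₀, -⟩ := exists_perpendicular_route (h := h) (v := v) (c := c) (S := S) (D := D)
  refine Route.exists_isPolicyRoute (fun L => ?_) ?_ r₀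
  · refine (((Set.finite_singleton RoadIndex.source).insert RoadIndex.destination).union
      (((hg.hor_finite L).image RoadIndex.horizontal).union
        ((hg.ver_finite L).image RoadIndex.vertical))).subset ?_
    rintro (_ | _ | k | k) hk
    · simp
    · simp
    · exact Or.inr (Or.inl ⟨k, hk, rfl⟩)
    · exact Or.inr (Or.inr ⟨k, hk, rfl⟩)
  · rintro (_ | _ | k | k) (_ | _ | l | l) ho he <;>
      first
        | rfl
        | exact absurd he (hg.hor_ne_source _)
        | exact absurd he.symm (hg.hor_ne_source _)
        | exact absurd he (hg.ver_ne_destination _)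
        | exact absurd he.symm (hg.ver_ne_destination _)
        | exact congrArg _ (hg.hor_injective he)
        | exact congrArg _ (hg.ver_injective he)
        | cases ho

/-- When a trip between perpendicular roads does without charging: there is no horizontal road in
between, or there is one but no vertical road, or there are both and none is charging. -/
def PerpendicularUncharged (h v : ℕ → ℝ) (c : RoadIndex → Bool) (S D : ℝ × ℝ) : Prop :=
  (∀ k, h k ∉ Set.uIoo S.2 D.2) ∨
  ((∃ k, h k ∈ Set.uIoo S.2 D.2) ∧ ∀ k, v k ∉ Set.uIoo S.1 D.1) ∨
  ((∃ k, h k ∈ Set.uIoo S.2 D.2) ∧ (∃ k, v k ∈ Set.uIoo S.1 D.1) ∧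
    (∀ k, h k ∈ Set.uIoo S.2 D.2 → c (.horizontal k) = false) ∧
    ∀ k, v k ∈ Set.uIoo S.1 D.1 → c (.vertical k) = false)

lemma IsGeneric.chargingLength_eq_zero_perpendicular (hg : IsGeneric h v S D)
    (hcS : c .source = false) (hcD : c .destination = false)
    (hW : PerpendicularUncharged h v c S D) (r : Route (perpendicularNetwork h v c S D) S D)
    (hr : r.IsShortest) : r.chargingLength = 0 := by
  obtain ⟨r₀, hr₀, -⟩ := exists_perpendicular_route (h := h) (v := v) (c := c) (S := S) (D := D)
  have hlen := hr r₀
  rw [hr₀] at hlen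
  have hmemh : ∀ j, h j ∈ Set.uIcc S.2 D.2 → h j ∈ Set.uIoo S.2 D.2 := fun j hj =>
    mem_uIoo_of_mem_uIcc hj (hg.hor_ne_source j) (hg.hor_ne_destination j)
  have hmemv : ∀ j, v j ∈ Set.uIcc S.1 D.1 → v j ∈ Set.uIoo S.1 D.1 := fun j hj =>
    mem_uIoo_of_mem_uIcc hj (hg.ver_ne_source j) (hg.ver_ne_destination j)
  rcases hW with hW | ⟨-, hW⟩ | ⟨-, -, hch, hcv⟩
  · refine r.chargingLength_eq_zero_of_horizontal_unique hlen ?_ ?_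
    · rintro (_ | _ | j | j) hj hjm
      · exact ⟨rfl, by simp [perpendicularNetwork, hcS]⟩
      · cases hj
      · exact absurd (hmemh j hjm) (hW j)
      · cases hj
    · rintro (_ | _ | j | j) hj hjS
      · cases hj
      · simp [perpendicularNetwork, hcD]
      · cases hj
      · exact absurd hjS (hg.ver_ne_destination j)
  · refine r.chargingLength_eq_zero_of_vertical_unique hlen ?_ ?_
    · rintro (_ | _ | j | j) hj hjS
      · simp [perpendicularNetwork, hcS]
      · cases hj
      · exact absurd hjS (hg.hor_ne_source j)
      · cases hj
    · rintro (_ | _ | j | j) hj hjm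
      · cases hj
      · exact ⟨rfl, by simp [perpendicularNetwork, hcD]⟩
      · cases hj
      · exact absurd (hmemv j hjm) (hW j)
  · refine r.chargingLength_eq_zero_of_forall_notMem hlen ?_ ?_
    · rintro (_ | _ | j | j) hj hjc hjm
      · simp [perpendicularNetwork, hcS] at hjc
      · cases hj
      · simp [perpendicularNetwork, hch j (hmemh j hjm)] at hjc
      · cases hj
    · rintro (_ | _ | j | j) hj hjc hjm
      · cases hj
      · simp [perpendicularNetwork, hcD] at hjc
      · cases hj
      · simp [perpendicularNetwork, hcv j (hmemv j hjm)] at hjc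

/-- A horizontal and a vertical road in between give a direct staircase with positive distance on
both, so one of them charging suffices. -/
lemma IsGeneric.exists_chargingLength_pos_perpendicular (hg : IsGeneric h v S D)
    (hSD1 : S.1 ≠ D.1) (hSD2 : S.2 ≠ D.2)
    (hW : ¬(c .source = false ∧ c .destination = false ∧ PerpendicularUncharged h v c S D)) :
    ∃ r : Route (perpendicularNetwork h v c S D) S D, r.IsShortest ∧ 0 < r.chargingLength := by
  have h1 : 0 < |S.1 - D.1| := abs_pos.2 (sub_ne_zero.2 hSD1)
  have h2 : 0 < |S.2 - D.2| := abs_pos.2 (sub_ne_zero.2 hSD2)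
  obtain ⟨r₀, hr₀, hc₀⟩ := exists_perpendicular_route (h := h) (v := v) (c := c) (S := S) (D := D)
  by_cases hcSD : c .source = true ∨ c .destination = true
  · refine ⟨r₀, isShortest_of_length_le hr₀.le, ?_⟩
    rw [hc₀]
    rcases hcSD with hc | hc <;> rw [if_pos hc] <;> split_ifs <;> linarith
  push Not at hcSD
  simp only [ne_eq, Bool.not_eq_true] at hcSD
  have hvia : ∀ k m, h k ∈ Set.uIoo S.2 D.2 → v m ∈ Set.uIoo S.1 D.1 →
      (c (.vertical m) = true ∨ c (.horizontal k) = true) →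
      ∃ r : Route (perpendicularNetwork h v c S D) S D, r.IsShortest ∧ 0 < r.chargingLength := by
    intro k m hk hm hckm
    obtain ⟨r, hr, hrc⟩ := exists_perpendicular_route_between (c := c) (mem_uIcc_of_mem_uIoo hk)
      (mem_uIcc_of_mem_uIoo hm)
    refine ⟨r, isShortest_of_length_le hr.le, lt_of_lt_of_le ?_ hrc⟩
    have h3 : 0 < |S.2 - h k| := abs_pos.2 (sub_ne_zero.2 (hg.hor_ne_source k).symm)
    have h4 : 0 < |v m - D.1| := abs_pos.2 (sub_ne_zero.2 (hg.ver_ne_destination m))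
    rcases hckm with hc | hc <;> rw [if_pos hc] <;> split_ifs <;> linarith
  have hW' : ¬PerpendicularUncharged h v c S D := fun h' => hW ⟨hcSD.1, hcSD.2, h'⟩
  unfold PerpendicularUncharged at hW'
  push Not at hW'
  obtain ⟨⟨k, hk⟩, hW2, hW3⟩ := hW'
  obtain ⟨m, hm⟩ := hW2 ⟨k, hk⟩
  by_cases hch : ∃ j, h j ∈ Set.uIoo S.2 D.2 ∧ c (.horizontal j) = true
  · obtain ⟨j, hj, hcj⟩ := hch
    exact hvia j m hj hm (Or.inr hcj)
  · push Not at hch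
    obtain ⟨j, hj, hcj⟩ := hW3 ⟨k, hk⟩ ⟨m, hm⟩ (by simpa using hch)
    exact hvia k j hk hj (Or.inl (by simpa using hcj))

end

/-! ### The network of a trip -/

namespace TripModel

variable {Ω : Type*} [MeasurableSpace Ω] {P : Measure Ω} {lam p : ℝ} {M : TripModel P lam p}
  {S D : ℝ × ℝ} {ω : Ω}

lemma network_eq_parallelNetwork (h : M.placement ω = .parallel) :
    M.network S D ω = parallelNetwork (fun k => M.hor k ω) (fun k => M.ver k ω)
      (fun i => M.charging i ω) S D := by
  simp only [network, parallelNetwork, RoadNetwork.mk.injEq, and_true]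
  constructor <;> funext i <;> cases i <;> simp [h]

lemma network_eq_perpendicularNetwork (h : M.placement ω = .perpendicular) :
    M.network S D ω = perpendicularNetwork (fun k => M.hor k ω) (fun k => M.ver k ω)
      (fun i => M.charging i ω) S D := by
  simp only [network, perpendicularNetwork, RoadNetwork.mk.injEq, and_true]
  constructor <;> funext i <;> cases i <;> simp [h]

/-- The outcomes whose roads are in general position. -/
def Generic (M : TripModel P lam p) (S D : ℝ × ℝ) (ω : Ω) : Prop :=
  IsGeneric (fun k => M.hor k ω) (fun k => M.ver k ω) S D

/-- The event that the trip goes without charging between two parallel roads that are not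
charging. -/
def ParallelFailure (M : TripModel P lam p) (S D : ℝ × ℝ) : Set Ω :=
  {ω | (M.placement ω = .parallel ∧ M.charging .source ω = false ∧
    M.charging .destination ω = false) ∧
    ParallelUncharged (fun k => M.hor k ω) (fun k => M.ver k ω) (fun i => M.charging i ω) S D}

/-- The event that the trip goes without charging between two perpendicular roads that are not
charging. -/
def PerpendicularFailure (M : TripModel P lam p) (S D : ℝ × ℝ) : Set Ω :=
  {ω | (M.placement ω = .perpendicular ∧ M.charging .source ω = false ∧
    M.charging .destination ω = false) ∧
    PerpendicularUncharged (fun k => M.hor k ω) (fun k => M.ver k ω)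
      (fun i => M.charging i ω) S D}

lemma Generic.exists_isPolicyRoute (hg : M.Generic S D ω) (hSD : S.1 ≠ D.1) :
    ∃ r : Route (M.network S D ω) S D, r.IsPolicyRoute := by
  rcases h : M.placement ω with _ | _
  · rw [network_eq_parallelNetwork h]
    exact IsGeneric.exists_isPolicyRoute_parallel hg hSD
  · rw [network_eq_perpendicularNetwork h]
    exact IsGeneric.exists_isPolicyRoute_perpendicular hg

lemma Generic.mem_Tc_iff (hg : M.Generic S D ω) (hSD1 : S.1 ≠ D.1) (hSD2 : S.2 ≠ D.2) :
    ω ∈ M.Tc S D ↔ ω ∉ M.ParallelFailure S D ∪ M.PerpendicularFailure S D := by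
  -- A policy route exists and maximises charging among shortest routes, so any shortest route with
  -- charging is a sufficient witness.
  have key : ω ∈ M.Tc S D ↔ ∃ r : Route (M.network S D ω) S D,
      r.IsShortest ∧ 0 < r.chargingLength := by
    constructor
    · rintro ⟨r, hr, hc⟩
      exact ⟨r, hr.1, hc⟩
    · rintro ⟨r', hr', hc⟩
      obtain ⟨r, hr⟩ := hg.exists_isPolicyRoute hSD1
      exact ⟨r, hr, hr.chargingLength_pos hr' hc⟩
  rw [key]
  rcases h : M.placement ω with _ | _
  · rw [network_eq_parallelNetwork h]
    constructor
    · rintro ⟨r, hr, hc⟩ (hW | hW)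
      · exact hc.ne' (IsGeneric.chargingLength_eq_zero_parallel hg hSD1 hW.1.2.1 hW.1.2.2
          hW.2 r hr)
      · exact Placement.noConfusion (h.symm.trans hW.1.1)
    · intro hW
      refine IsGeneric.exists_chargingLength_pos_parallel hg hSD1 fun hW' => hW (Or.inl ?_)
      exact ⟨⟨h, hW'.1, hW'.2.1⟩, hW'.2.2⟩
  · rw [network_eq_perpendicularNetwork h]
    constructor
    · rintro ⟨r, hr, hc⟩ (hW | hW)
      · exact Placement.noConfusion (h.symm.trans hW.1.1)
      · exact hc.ne' (IsGeneric.chargingLength_eq_zero_perpendicular hg hW.1.2.1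
          hW.1.2.2 hW.2 r hr)
    · intro hW
      refine IsGeneric.exists_chargingLength_pos_perpendicular hg hSD1 hSD2
        fun hW' => hW (Or.inr ?_)
      exact ⟨⟨h, hW'.1, hW'.2.1⟩, hW'.2.2⟩

end TripModel

/-! ## Poisson processes -/

lemma measurableSet_preimage_eq {B : Set ℝ} (hB : MeasurableSet B) (A : Set ℕ) :
    MeasurableSet {x : ℕ → ℝ | {k | x k ∈ B} = A} := by
  have : {x : ℕ → ℝ | {k | x k ∈ B} = A} = ⋂ k, {x | x k ∈ B ↔ k ∈ A} := by
    ext x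
    simp [Set.ext_iff]
  rw [this]
  refine MeasurableSet.iInter fun k => ?_
  have hk : MeasurableSet {x : ℕ → ℝ | x k ∈ B} := measurable_pi_apply k hB
  by_cases hkA : k ∈ A
  · simpa [hkA] using hk
  · simp only [hkA, iff_false]
    exact hk.compl

lemma measurableSet_detour_lt (a b : ℝ) (j k : ℕ) :
    MeasurableSet {x : ℕ → ℝ | detour a b (x k) < detour a b (x j)} := by
  refine measurableSet_lt ?_ ?_ <;>
  · unfold detour
    fun_prop

/-- The charging-free weight of a family of events that is indexed by the finite set of the roads
which must not be charging. -/
noncomputable def weight {Ω : Type*} [MeasurableSpace Ω] (P : Measure Ω) (q : ℝ) (X : ℕ → Ω → ℝ)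
    (U : Finset ℕ → Set (ℕ → ℝ)) : ENNReal :=
  ∑' A : Finset ℕ, P {ω | (fun k => X k ω) ∈ U A} * ENNReal.ofReal q ^ A.card

/-- Measurable and pairwise disjoint families of events. -/
structure IsFamily (U : Finset ℕ → Set (ℕ → ℝ)) : Prop where
  measurableSet : ∀ A, MeasurableSet (U A)
  disjoint : ∀ A A' x, x ∈ U A → x ∈ U A' → A = A'

/-- The points in `B` are exactly those of the index set, and they are at least `m`. -/
def pointsEq (B : Set ℝ) (m : ℕ) (A : Finset ℕ) : Set (ℕ → ℝ) :=
  {x | m ≤ A.card ∧ {k | x k ∈ B} = ↑A}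

/-- The event `E` without any demand on charging. -/
def noDemand (E : Set (ℕ → ℝ)) (A : Finset ℕ) : Set (ℕ → ℝ) := {x | A = ∅ ∧ x ∈ E}

/-- The unique point with the shortest detour is that of the index set. -/
def shortestDetour (a b : ℝ) (A : Finset ℕ) : Set (ℕ → ℝ) :=
  {x | ∃ k, A = {k} ∧ ∀ j, j ≠ k → detour a b (x k) < detour a b (x j)}

lemma isFamily_pointsEq {B : Set ℝ} (hB : MeasurableSet B) (m : ℕ) :
    IsFamily (pointsEq B m) where
  measurableSet A := (MeasurableSet.const _).inter (measurableSet_preimage_eq hB _)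
  disjoint A A' x h h' := by
    have := h.2.symm.trans h'.2
    exact_mod_cast this

lemma isFamily_noDemand {E : Set (ℕ → ℝ)} (hE : MeasurableSet E) : IsFamily (noDemand E) where
  measurableSet _ := (MeasurableSet.const _).inter hE
  disjoint _ _ _ h h' := h.1.trans h'.1.symm

lemma isFamily_shortestDetour (a b : ℝ) : IsFamily (shortestDetour a b) where
  measurableSet A := by
    have : shortestDetour a b A = ⋃ k, {x | A = {k}} ∩
        ⋂ j, {x : ℕ → ℝ | j ≠ k → detour a b (x k) < detour a b (x j)} := by
      ext x
      simp [shortestDetour]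
    rw [this]
    refine MeasurableSet.iUnion fun k => (MeasurableSet.const _).inter
      (MeasurableSet.iInter fun j => ?_)
    by_cases hjk : j = k
    · simp [hjk]
    · simpa [hjk] using measurableSet_detour_lt a b j k
  disjoint := by
    rintro A A' x ⟨k, rfl, hk⟩ ⟨l, rfl, hl⟩
    by_contra hne
    have hkl : k ≠ l := fun h => hne (by rw [h])
    exact lt_asymm (hk l hkl.symm) (hl k hkl)

/-- Charging marks belong to indices, so the count has to be refined to the set of indices. -/
lemma setOf_pointCount_eq {Ω : Type*} (X : ℕ → Ω → ℝ) (B : Set ℝ) (n : ℕ) :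
    {ω | pointCount X B ω = n} =
      ⋃ A : {A : Finset ℕ // A.card = n}, {ω | {k | X k ω ∈ B} = ↑A.1} := by
  ext ω
  simp only [pointCount, Set.mem_iUnion, Set.mem_ofPred_eq]
  constructor
  · intro h
    have hfin : {k | X k ω ∈ B}.Finite := Set.finite_of_encard_eq_coe h
    refine ⟨⟨hfin.toFinset, ?_⟩, by simp⟩
    rw [hfin.encard_eq_coe_toFinset_card] at h
    exact_mod_cast h
  · rintro ⟨⟨A, rfl⟩, hA⟩
    rw [hA, Set.encard_coe_eq_coe_finsetCard]

lemma setOf_forall_notMem {Ω : Type*} (X : ℕ → Ω → ℝ) (B : Set ℝ) :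
    {ω | ∀ k, X k ω ∉ B} = {ω | pointCount X B ω = (0 : ℕ)} := by
  ext ω
  simp [pointCount, Set.eq_empty_iff_forall_notMem]

namespace IsPoissonProcess

variable {Ω : Type*} [MeasurableSpace Ω] {P : Measure Ω} {lam : ℝ} {X : ℕ → Ω → ℝ}

lemma measurable_path (hX : IsPoissonProcess P lam X) : Measurable fun ω k => X k ω :=
  measurable_pi_lambda _ hX.measurable

lemma measurableSet_points_eq (hX : IsPoissonProcess P lam X) {B : Set ℝ} (hB : MeasurableSet B)
    (A : Set ℕ) : MeasurableSet {ω | {k | X k ω ∈ B} = A} :=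
  hX.measurable_path (measurableSet_preimage_eq hB A)

lemma measurableSet_pointCount_eq (hX : IsPoissonProcess P lam X) {B : Set ℝ}
    (hB : MeasurableSet B) (n : ℕ) : MeasurableSet {ω | pointCount X B ω = n} := by
  rw [setOf_pointCount_eq]
  exact MeasurableSet.iUnion fun A => hX.measurableSet_points_eq hB _

lemma measure_pointCount_eq (hX : IsPoissonProcess P lam X) {B : Set ℝ} (hB : MeasurableSet B)
    {d : ℝ} (hd : 0 ≤ d) (hBd : volume B = ENNReal.ofReal d) (n : ℕ) :
    P {ω | pointCount X B ω = n} =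
      ENNReal.ofReal ((lam * d) ^ n / n.factorial * Real.exp (-(lam * d))) := by
  rw [hX.count_law B hB (by simp [hBd]) n, hBd, ENNReal.toReal_ofReal hd]

lemma measure_pointCount_eq_tsum (hX : IsPoissonProcess P lam X) {B : Set ℝ}
    (hB : MeasurableSet B) (n : ℕ) : P {ω | pointCount X B ω = n} =
      ∑' A : {A : Finset ℕ // A.card = n}, P {ω | {k | X k ω ∈ B} = ↑A.1} := by
  rw [setOf_pointCount_eq, measure_iUnion]
  · intro A A' hne
    refine Set.disjoint_left.2 fun ω h h' => hne (Subtype.ext ?_)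
    have := h.symm.trans h'
    exact_mod_cast this
  · exact fun A => hX.measurableSet_points_eq hB _

/-- Thinning as a computation: grouped by cardinality, the weight is the Poisson generating function
at `q` without its first `m` terms. -/
lemma weight_pointsEq (hX : IsPoissonProcess P lam X) (hlam : 0 ≤ lam) {B : Set ℝ}
    (hB : MeasurableSet B) {d : ℝ} (hd : 0 ≤ d) (hBd : volume B = ENNReal.ofReal d) {q : ℝ}
    (hq : 0 ≤ q) (m : ℕ) :
    weight P q X (pointsEq B m) = ENNReal.ofReal (Real.exp (-(lam * (1 - q) * d)) -
      ∑ n ∈ Finset.range m, (lam * d * q) ^ n / n.factorial * Real.exp (-(lam * d))) := by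
  have h1 : weight P q X (pointsEq B m) = ∑' n : ℕ, ENNReal.ofReal
      (if m ≤ n then (lam * d * q) ^ n / n.factorial * Real.exp (-(lam * d)) else 0) := by
    unfold weight
    rw [← ENNReal.tsum_fiberwise _ Finset.card]
    refine tsum_congr fun n => ?_
    by_cases hmn : m ≤ n
    · rw [if_pos hmn, mul_pow, mul_div_right_comm, mul_right_comm,
        ENNReal.ofReal_mul (by positivity), ← hX.measure_pointCount_eq hB hd hBd,
        hX.measure_pointCount_eq_tsum hB, ← ENNReal.tsum_mul_right]
      refine tsum_congr fun A => ?_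
      have hA : A.1.card = n := A.2
      rw [hA, ENNReal.ofReal_pow hq]
      congr 2
      ext ω
      simp only [pointsEq, Set.mem_ofPred_eq, hA]
      exact and_iff_right hmn
    · rw [if_neg hmn, ENNReal.ofReal_zero, ENNReal.tsum_eq_zero]
      intro A
      have hA : A.1.card = n := A.2
      have : {ω | (fun k => X k ω) ∈ pointsEq B m A.1} = ∅ := by
        ext ω
        simp [pointsEq, hA, hmn]
      rw [this, measure_empty, zero_mul]
  have h2 : HasSum (fun n : ℕ => (lam * d * q) ^ n / n.factorial * Real.exp (-(lam * d)))
      (Real.exp (-(lam * (1 - q) * d))) := by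
    have := (NormedSpace.expSeries_div_hasSum_exp (lam * d * q)).mul_right (Real.exp (-(lam * d)))
    rw [← Real.exp_eq_exp_ℝ, ← Real.exp_add] at this
    rwa [show lam * d * q + -(lam * d) = -(lam * (1 - q) * d) by ring] at this
  have h3 := h2.sub (hasSum_sum_of_ne_finset_zero (s := Finset.range m) (f := fun n : ℕ =>
    if n < m then (lam * d * q) ^ n / n.factorial * Real.exp (-(lam * d)) else 0)
    (fun n hn => by simp at hn; simp [hn]))
  have h4 : HasSum (fun n : ℕ =>
      (if m ≤ n then (lam * d * q) ^ n / n.factorial * Real.exp (-(lam * d)) else 0))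
      (Real.exp (-(lam * (1 - q) * d)) -
      ∑ n ∈ Finset.range m, (lam * d * q) ^ n / n.factorial * Real.exp (-(lam * d))) := by
    have e1 : (fun n : ℕ =>
        (if m ≤ n then (lam * d * q) ^ n / n.factorial * Real.exp (-(lam * d)) else 0)) =
        fun n : ℕ => (lam * d * q) ^ n / n.factorial * Real.exp (-(lam * d)) -
          if n < m then (lam * d * q) ^ n / n.factorial * Real.exp (-(lam * d)) else 0 := by
      funext n
      rcases lt_or_ge n m with h | h
      · simp [h]
      · simp [h, not_lt.2 h]
    rw [e1, ← Finset.sum_congr rfl fun n hn => if_pos (Finset.mem_range.1 hn)]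
    exact h3
  rw [h1, ← h4.tsum_eq, ENNReal.ofReal_tsum_of_nonneg _ h4.summable]
  intro n
  split_ifs <;> positivity

lemma weight_noDemand (q : ℝ) (E : Set (ℕ → ℝ)) :
    weight P q X (noDemand E) = P {ω | (fun k => X k ω) ∈ E} := by
  unfold weight
  rw [tsum_eq_single ∅]
  · simp [noDemand]
  · intro A hA
    simp [noDemand, hA]

/-- For `q = 1` and `m = 0` the weight is the probability of finitely many points in `B`, and its
closed form is `exp 0 = 1`. -/
lemma ae_finite [IsProbabilityMeasure P] (hX : IsPoissonProcess P lam X) (hlam : 0 ≤ lam)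
    {B : Set ℝ} (hB : MeasurableSet B) {d : ℝ} (hd : 0 ≤ d) (hBd : volume B = ENNReal.ofReal d) :
    ∀ᵐ ω ∂P, {k | X k ω ∈ B}.Finite := by
  have hmeas : ∀ A, MeasurableSet {ω | (fun k => X k ω) ∈ pointsEq B 0 A} := fun A =>
    hX.measurable_path ((isFamily_pointsEq hB 0).measurableSet A)
  have h1 : P (⋃ A, {ω | (fun k => X k ω) ∈ pointsEq B 0 A}) = 1 := by
    rw [measure_iUnion]
    · have := hX.weight_pointsEq hlam hB hd hBd zero_le_one 0
      simpa [weight] using this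
    · exact fun A A' hne => Set.disjoint_left.2 fun ω h h' =>
        hne ((isFamily_pointsEq hB 0).disjoint A A' _ h h')
    · exact hmeas
  have h2 := (mem_ae_iff_prob_eq_one (MeasurableSet.iUnion hmeas)).2 h1
  filter_upwards [h2] with ω hω
  obtain ⟨A, hA⟩ := Set.mem_iUnion.1 hω
  rw [hA.2]
  exact A.finite_toSet

lemma ae_forall_finite [IsProbabilityMeasure P] (hX : IsPoissonProcess P lam X) (hlam : 0 ≤ lam) :
    ∀ᵐ ω ∂P, ∀ L : ℝ, {k | |X k ω| ≤ L}.Finite := by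
  have h : ∀ n : ℕ, ∀ᵐ ω ∂P, {k | X k ω ∈ Set.Icc (-(n : ℝ)) n}.Finite := fun n =>
    hX.ae_finite hlam measurableSet_Icc (d := 2 * n) (by positivity)
      (by rw [Real.volume_Icc]; congr 1; ring)
  filter_upwards [ae_all_iff.2 h] with ω hω L
  obtain ⟨n, hn⟩ := exists_nat_ge L
  exact (hω n).subset fun k hk => abs_le.1 (le_trans hk hn)

lemma measure_forall_notMem (hX : IsPoissonProcess P lam X) {B : Set ℝ} (hB : MeasurableSet B)
    {d : ℝ} (hd : 0 ≤ d) (hBd : volume B = ENNReal.ofReal d) :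
    P {ω | ∀ k, X k ω ∉ B} = ENNReal.ofReal (Real.exp (-(lam * d))) := by
  rw [setOf_forall_notMem, hX.measure_pointCount_eq hB hd hBd]
  simp

lemma measurableSet_forall_notMem (hX : IsPoissonProcess P lam X) {B : Set ℝ}
    (hB : MeasurableSet B) : MeasurableSet {ω | ∀ k, X k ω ∉ B} := by
  rw [setOf_forall_notMem]
  exact hX.measurableSet_pointCount_eq hB 0

lemma measure_exists_mem [IsProbabilityMeasure P] (hX : IsPoissonProcess P lam X) {B : Set ℝ}
    (hB : MeasurableSet B) {d : ℝ} (hd : 0 ≤ d) (hBd : volume B = ENNReal.ofReal d) :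
    P {ω | ∃ k, X k ω ∈ B} = ENNReal.ofReal (1 - Real.exp (-(lam * d))) := by
  have : {ω | ∃ k, X k ω ∈ B} = {ω | ∀ k, X k ω ∉ B}ᶜ := by
    ext ω
    simp
  rw [this, prob_compl_eq_one_sub (hX.measurableSet_forall_notMem hB),
    hX.measure_forall_notMem hB hd hBd, ENNReal.ofReal_sub _ (Real.exp_pos _).le,
    ENNReal.ofReal_one]

lemma ae_ne [IsProbabilityMeasure P] (hX : IsPoissonProcess P lam X) (y : ℝ) :
    ∀ᵐ ω ∂P, ∀ k, X k ω ≠ y := by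
  have h := hX.measure_forall_notMem (measurableSet_singleton y) le_rfl (by simp)
  simp only [mul_zero, neg_zero, Real.exp_zero, ENNReal.ofReal_one] at h
  have h2 := (mem_ae_iff_prob_eq_one
    (hX.measurableSet_forall_notMem (measurableSet_singleton y))).2 h
  filter_upwards [h2] with ω hω k
  exact hω k

lemma measure_exists_mem_le [IsProbabilityMeasure P] (hX : IsPoissonProcess P lam X) {B : Set ℝ}
    (hB : MeasurableSet B) {d : ℝ} (hd : 0 ≤ d) (hBd : volume B = ENNReal.ofReal d) :
    P {ω | ∃ k, X k ω ∈ B} ≤ ENNReal.ofReal (lam * d) := by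
  rw [hX.measure_exists_mem hB hd hBd]
  have := Real.one_sub_le_exp_neg (lam * d)
  exact ENNReal.ofReal_le_ofReal (by linarith)

lemma measure_exists_mem_and_exists_mem (hX : IsPoissonProcess P lam X) {B C : Set ℝ}
    (hB : MeasurableSet B) (hC : MeasurableSet C) (hBC : Disjoint B C) :
    P ({ω | ∃ k, X k ω ∈ B} ∩ {ω | ∃ k, X k ω ∈ C}) =
      P {ω | ∃ k, X k ω ∈ B} * P {ω | ∃ k, X k ω ∈ C} := by
  have hind := hX.count_indep 2 ![B, C] (by intro j; fin_cases j <;> simpa)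
    (by
      intro i j hij
      fin_cases i <;> fin_cases j <;> first | exact absurd rfl hij | exact hBC | exact hBC.symm)
  have h2 := (hind.indepFun (i := 0) (j := 1) (by decide)).measure_inter_preimage_eq_mul {0}ᶜ {0}ᶜ
    (measurableSet_singleton _).compl (measurableSet_singleton _).compl
  have h3 : ∀ B : Set ℝ, pointCount X B ⁻¹' {0}ᶜ = {ω | ∃ k, X k ω ∈ B} := by
    intro B
    ext ω
    simp [pointCount, Set.eq_empty_iff_forall_notMem]
  simpa [h3] using h2

/-- Two points with sum `c` mirror each other about `c / 2`. Cut a stretch of length `M` to the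
right of `c / 2` into `n` cells: such a pair occupies a cell and its mirror image, which are
disjoint and hence independent. The probability is at most `n * (lam * M / n) ^ 2`, which tends to
zero. -/
lemma ae_add_ne [IsProbabilityMeasure P] (hX : IsPoissonProcess P lam X) (hlam : 0 ≤ lam)
    (c : ℝ) : ∀ᵐ ω ∂P, ∀ j k, j ≠ k → X j ω + X k ω ≠ c := by
  have key : ∀ M : ℕ, 0 < M →
      P {ω | ∃ j k, c / 2 < X j ω ∧ X j ω ≤ c / 2 + M ∧ X j ω + X k ω = c} = 0 := by
    intro M hM
    have hM' : (0 : ℝ) < M := by exact_mod_cast hM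
    have hbound : ∀ n : ℕ, 0 < n →
        P {ω | ∃ j k, c / 2 < X j ω ∧ X j ω ≤ c / 2 + M ∧ X j ω + X k ω = c} ≤
          ENNReal.ofReal ((lam * M) ^ 2 / n) := by
      intro n hn
      have hn' : (0 : ℝ) < n := by exact_mod_cast hn
      set δ : ℝ := M / n with hδ
      have hδ0 : 0 < δ := by positivity
      -- `C i` is the reflection of `B i`, which swaps the closed end; `c / 2` itself belongs to no
      -- `B i`.
      set B : ℕ → Set ℝ := fun i => Set.Ioc (c / 2 + i * δ) (c / 2 + (i + 1) * δ) with hBdef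
      set C : ℕ → Set ℝ := fun i => Set.Ico (c / 2 - (i + 1) * δ) (c / 2 - i * δ) with hCdef
      have hB : ∀ i, volume (B i) = ENNReal.ofReal δ := fun i => by
        rw [hBdef, Real.volume_Ioc]; congr 1; ring
      have hC : ∀ i, volume (C i) = ENNReal.ofReal δ := fun i => by
        rw [hCdef, Real.volume_Ico]; congr 1; ring
      have hsub : {ω | ∃ j k, c / 2 < X j ω ∧ X j ω ≤ c / 2 + M ∧ X j ω + X k ω = c} ⊆
          ⋃ i ∈ Finset.range n, {ω | ∃ k, X k ω ∈ B i} ∩ {ω | ∃ k, X k ω ∈ C i} := by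
        rintro ω ⟨j, k, h1, h2, h3⟩
        have hpos : 0 < (X j ω - c / 2) / δ := div_pos (by linarith) hδ0
        have hle : (X j ω - c / 2) / δ ≤ n := by
          rw [div_le_iff₀ hδ0, hδ, mul_div_cancel₀ _ hn'.ne']
          linarith
        obtain ⟨i, hi⟩ := Nat.exists_eq_succ_of_ne_zero (Nat.ceil_pos.2 hpos).ne'
        have hu := Nat.le_ceil ((X j ω - c / 2) / δ)
        have hl := Nat.ceil_lt_add_one hpos.le
        have hceil := Nat.ceil_le.2 hle
        rw [hi] at hu hl hceil
        push_cast at hu hl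
        rw [div_le_iff₀ hδ0] at hu
        have hl' : (i : ℝ) < (X j ω - c / 2) / δ := by linarith
        rw [lt_div_iff₀ hδ0] at hl'
        refine Set.mem_biUnion (Finset.mem_coe.2 (Finset.mem_range.2 hceil)) ⟨⟨j, ?_⟩, ⟨k, ?_⟩⟩
        · constructor <;> linarith
        · constructor <;> linarith
      calc P {ω | ∃ j k, c / 2 < X j ω ∧ X j ω ≤ c / 2 + M ∧ X j ω + X k ω = c}
          ≤ ∑ i ∈ Finset.range n, P ({ω | ∃ k, X k ω ∈ B i} ∩ {ω | ∃ k, X k ω ∈ C i}) :=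
            (measure_mono hsub).trans (measure_biUnion_finset_le _ _)
        _ ≤ ∑ i ∈ Finset.range n, ENNReal.ofReal (lam * δ) * ENNReal.ofReal (lam * δ) := by
            refine Finset.sum_le_sum fun i _ => ?_
            rw [hX.measure_exists_mem_and_exists_mem measurableSet_Ioc measurableSet_Ico]
            · exact mul_le_mul' (hX.measure_exists_mem_le measurableSet_Ioc hδ0.le (hB i))
                (hX.measure_exists_mem_le measurableSet_Ico hδ0.le (hC i))
            · refine Set.disjoint_left.2 fun x hx hx' => ?_
              have := hx.1
              have := hx'.2
              have : 0 ≤ i * δ := by positivity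
              linarith
        _ = ENNReal.ofReal ((lam * M) ^ 2 / n) := by
            rw [Finset.sum_const, Finset.card_range, nsmul_eq_mul,
              ← ENNReal.ofReal_mul (by positivity), ← ENNReal.ofReal_natCast,
              ← ENNReal.ofReal_mul (by positivity), hδ]
            congr 1
            field_simp
    have hlim : Filter.Tendsto (fun n : ℕ => ENNReal.ofReal ((lam * M) ^ 2 / n)) Filter.atTop
        (nhds 0) := by
      rw [← ENNReal.ofReal_zero]
      exact ENNReal.tendsto_ofReal (tendsto_const_div_atTop_nhds_zero_nat _)
    exact le_antisymm (ge_of_tendsto hlim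
      (Filter.eventually_atTop.2 ⟨1, fun n hn => hbound n hn⟩)) zero_le
  have h0 : ∀ M : ℕ, ∀ᵐ ω ∂P, 0 < M →
      ¬∃ j k, c / 2 < X j ω ∧ X j ω ≤ c / 2 + M ∧ X j ω + X k ω = c := by
    intro M
    rcases Nat.eq_zero_or_pos M with rfl | hM
    · simp
    · filter_upwards [(compl_mem_ae_iff.2 (key M hM))] with ω hω _ using hω
  filter_upwards [ae_all_iff.2 h0, hX.distinct] with ω hω hinj j k hjk hsum
  have hside : ∀ j k, c / 2 < X j ω → X j ω + X k ω ≠ c := by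
    intro j k hj hjk
    obtain ⟨M, hM⟩ := exists_nat_ge (X j ω - c / 2)
    have hM0 : 0 < M := by
      have : (0 : ℝ) < M := by linarith
      exact_mod_cast this
    exact hω M hM0 ⟨j, k, hj, by linarith, hjk⟩
  -- One of the two points is right of `c / 2`, unless both equal it, which injectivity forbids.
  rcases lt_trichotomy (X j ω) (c / 2) with h | h | h
  · exact hside k j (by linarith) (by linarith)
  · exact hjk (hinj (show X j ω = X k ω by linarith))
  · exact hside j k h hsum

end IsPoissonProcess

/-- Two points in between forbid a unique shortest detour. -/
lemma not_shortestDetour_of_mem_uIoo {h : ℕ → ℝ} {a b : ℝ} {k l m : ℕ} (hkl : k ≠ l)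
    (hk : h k ∈ Set.uIoo a b) (hl : h l ∈ Set.uIoo a b) :
    ¬∀ j, j ≠ m → detour a b (h m) < detour a b (h j) := by
  intro hm
  have h1 := abs_sub_le_detour a b (h m)
  by_cases hkm : k = m
  · have h2 := hm l (fun e => hkl (hkm.trans e.symm))
    rw [detour_eq_of_mem_uIcc (mem_uIcc_of_mem_uIoo hl)] at h2
    linarith
  · have h2 := hm k hkm
    rw [detour_eq_of_mem_uIcc (mem_uIcc_of_mem_uIoo hk)] at h2
    linarith

/-- All points in between tie at the least possible value `|a - b|`; conversely, in general position
a tie consists of points in between. -/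
lemma exists_shortestDetour_iff {h : ℕ → ℝ} {a b : ℝ} (hinj : Function.Injective h)
    (hfin : ∀ L : ℝ, {k | |h k| ≤ L}.Finite) (ha : ∀ k, h k ≠ a) (hb : ∀ k, h k ≠ b)
    (hadd : ∀ j k, j ≠ k → h j + h k ≠ a + b) :
    (∃ k, ∀ j, j ≠ k → detour a b (h k) < detour a b (h j)) ↔
      {k | h k ∈ Set.uIoo a b}.encard ≤ 1 := by
  rw [Set.encard_le_one_iff]
  constructor
  · rintro ⟨m, hm⟩ k l hk hl
    by_contra hkl
    exact not_shortestDetour_of_mem_uIoo hkl hk hl hm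
  · intro h1
    obtain ⟨k, hk⟩ := exists_forall_detour_le hfin a b
    refine ⟨k, fun j hjk => lt_of_le_of_ne (hk j) fun he => hjk ?_⟩
    obtain ⟨h2, h3⟩ := mem_uIcc_of_detour_eq he.symm (fun e => hjk (hinj e)) (hadd j k hjk)
    exact h1 _ _ (mem_uIoo_of_mem_uIcc h2 (ha j) (hb j)) (mem_uIoo_of_mem_uIcc h3 (ha k) (hb k))

/-- Only singletons occur as index sets, so a single factor `q` comes out, and their union is almost
surely the event of at most one point in between. -/
lemma IsPoissonProcess.weight_shortestDetour {Ω : Type*} [MeasurableSpace Ω] {P : Measure Ω}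
    [IsProbabilityMeasure P] {lam : ℝ} {X : ℕ → Ω → ℝ} (hX : IsPoissonProcess P lam X)
    (hlam : 0 ≤ lam) {a b : ℝ} {q : ℝ} :
    weight P q X (shortestDetour a b) = ENNReal.ofReal (Real.exp (-(lam * |b - a|)) +
      lam * |b - a| * Real.exp (-(lam * |b - a|))) * ENNReal.ofReal q := by
  have hF := isFamily_shortestDetour a b
  have h1 : weight P q X (shortestDetour a b) =
      P (⋃ A, {ω | (fun k => X k ω) ∈ shortestDetour a b A}) * ENNReal.ofReal q := by
    have hmeas : ∀ A, MeasurableSet {ω | (fun k => X k ω) ∈ shortestDetour a b A} := fun A =>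
      hX.measurable_path (hF.measurableSet A)
    have hdisj : Pairwise (Function.onFun Disjoint
        fun A => {ω | (fun k => X k ω) ∈ shortestDetour a b A}) := fun A A' hne =>
      Set.disjoint_left.2 fun ω h h' => hne (hF.disjoint A A' _ h h')
    rw [measure_iUnion hdisj hmeas, ← ENNReal.tsum_mul_right]
    refine tsum_congr fun A => ?_
    by_cases hA : ∃ k, A = {k}
    · obtain ⟨k, rfl⟩ := hA
      simp
    · have : {ω | (fun k => X k ω) ∈ shortestDetour a b A} = ∅ := by
        ext ω
        simp only [Set.mem_ofPred_eq, Set.mem_empty_iff_false, iff_false]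
        rintro ⟨k, hk, -⟩
        exact hA ⟨k, hk⟩
      simp [this]
  have h2 : (⋃ A, {ω | (fun k => X k ω) ∈ shortestDetour a b A}) =ᵐ[P]
      ({ω | pointCount X (Set.uIoo a b) ω = (0 : ℕ)} ∪
        {ω | pointCount X (Set.uIoo a b) ω = (1 : ℕ)} : Set Ω) := by
    filter_upwards [hX.distinct, hX.ae_forall_finite hlam, hX.ae_ne a, hX.ae_ne b,
      hX.ae_add_ne hlam (a + b)] with ω w1 w2 w3 w4 w5
    have h3 := exists_shortestDetour_iff w1 w2 w3 w4 w5
    refine propext ?_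
    change (ω ∈ ⋃ A, {ω | (fun k => X k ω) ∈ shortestDetour a b A}) ↔
      (pointCount X (Set.uIoo a b) ω = (0 : ℕ) ∨ pointCount X (Set.uIoo a b) ω = (1 : ℕ))
    have h4 : (ω ∈ ⋃ A, {ω | (fun k => X k ω) ∈ shortestDetour a b A}) ↔
        ∃ k, ∀ j, j ≠ k → detour a b (X k ω) < detour a b (X j ω) := by
      simp [shortestDetour]
    rw [h4, h3, Nat.cast_zero, Nat.cast_one, ← Order.lt_one_iff, ← le_iff_lt_or_eq]
    rfl
  have hB : MeasurableSet (Set.uIoo a b) := measurableSet_Ioo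
  rw [h1, measure_congr h2, measure_union _ (hX.measurableSet_pointCount_eq hB 1),
    hX.measure_pointCount_eq hB (abs_nonneg _) Real.volume_uIoo,
    hX.measure_pointCount_eq hB (abs_nonneg _) Real.volume_uIoo,
    ← ENNReal.ofReal_add (by positivity) (by positivity)]
  · simp
  · refine Set.disjoint_left.2 fun ω h h' => ?_
    have := h.symm.trans h'
    norm_num at this

namespace TripModel

variable {Ω : Type*} [MeasurableSpace Ω] {P : Measure Ω} {lam p : ℝ}

/-! ## Probabilities of the events of a trip -/

lemma setOf_charging_eq_false (M : TripModel P lam p) (i : RoadIndex) :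
    {ω | M.charging i ω = false} = {ω | M.charging i ω = true}ᶜ := by
  ext ω
  simp

lemma measurableSet_placement_eq (M : TripModel P lam p) (π : Placement) :
    MeasurableSet {ω | M.placement ω = π} :=
  M.placement_measurable (t := {π}) trivial

lemma measurableSet_charging_eq (M : TripModel P lam p) (i : RoadIndex) (s : Bool) :
    MeasurableSet {ω | M.charging i ω = s} :=
  M.charging_measurable i (measurableSet_singleton s)

lemma measure_placement_eq [IsProbabilityMeasure P] (M : TripModel P lam p) (π : Placement) :
    P {ω | M.placement ω = π} = 1 / 2 := by
  cases π
  · exact M.placement_law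
  · have : {ω | M.placement ω = .perpendicular} = {ω | M.placement ω = .parallel}ᶜ := by
      ext ω
      cases h : M.placement ω <;> simp [h]
    rw [this, prob_compl_eq_one_sub (M.measurableSet_placement_eq _), M.placement_law]
    simp

lemma measure_charging_eq_false [IsProbabilityMeasure P] (M : TripModel P lam p) (hp0 : 0 ≤ p)
    (i : RoadIndex) : P {ω | M.charging i ω = false} = ENNReal.ofReal (1 - p) := by
  rw [setOf_charging_eq_false, prob_compl_eq_one_sub (M.measurableSet_charging_eq i true),
    M.charging_law, ENNReal.ofReal_sub _ hp0, ENNReal.ofReal_one]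

/-- Independence is peeled off in layers: placement, charging, horizontal against vertical roads,
and finally road by road. -/
lemma measure_roads_inter [IsProbabilityMeasure P] (M : TripModel P lam p) (hp0 : 0 ≤ p)
    {U V : Set (ℕ → ℝ)} (hU : MeasurableSet U) (hV : MeasurableSet V) (I : Finset RoadIndex)
    (π : Placement) :
    P {ω | (((fun k => M.hor k ω) ∈ U ∧ (fun k => M.ver k ω) ∈ V) ∧
      ∀ i ∈ I, M.charging i ω = false) ∧ M.placement ω = π} =
      P {ω | (fun k => M.hor k ω) ∈ U} * P {ω | (fun k => M.ver k ω) ∈ V} *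
        ENNReal.ofReal (1 - p) ^ I.card * (1 / 2) := by
  have hI : MeasurableSet {x : RoadIndex → Bool | ∀ i ∈ I, x i = false} := by
    have : {x : RoadIndex → Bool | ∀ i ∈ I, x i = false} = ⋂ i ∈ I, {x | x i = false} := by
      ext x
      simp
    rw [this]
    refine I.measurableSet_biInter fun i _ => ?_
    have hi : Measurable fun x : RoadIndex → Bool => x i := measurable_pi_apply i
    exact hi (measurableSet_singleton false)
  have h1 := M.indep_placement.measure_inter_preimage_eq_mul ((U ×ˢ V) ×ˢ {x | ∀ i ∈ I, x i = false})
    {π} ((hU.prod hV).prod hI) trivial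
  have h2 := M.indep_charging.measure_inter_preimage_eq_mul (U ×ˢ V) {x | ∀ i ∈ I, x i = false}
    (hU.prod hV) hI
  have h3 := M.indep_hor_ver.measure_inter_preimage_eq_mul U V hU hV
  have h4 := M.charging_indep.measure_inter_preimage_eq_mul I (sets := fun _ => {false})
    (fun _ _ => measurableSet_singleton _)
  have h5 : ∏ i ∈ I, P (M.charging i ⁻¹' {false}) = ENNReal.ofReal (1 - p) ^ I.card := by
    rw [← Finset.prod_const]
    exact Finset.prod_congr rfl fun i _ => M.measure_charging_eq_false hp0 i
  have h6 : (⋂ i ∈ I, M.charging i ⁻¹' {false}) =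
      (fun ω i => M.charging i ω) ⁻¹' {x | ∀ i ∈ I, x i = false} := by
    ext ω
    simp
  rw [h5, h6] at h4
  rw [← M.measure_placement_eq π, ← h4]
  refine h1.trans ?_
  congr 1
  refine h2.trans ?_
  congr 1

/-- The event that the roads are as described by `U` and `V` and that source, destination and the
roads of the index sets are not charging. -/
def patternEvent (M : TripModel P lam p) (U V : Finset ℕ → Set (ℕ → ℝ)) (π : Placement) : Set Ω :=
  {ω | ∃ A B : Finset ℕ, (fun k => M.hor k ω) ∈ U A ∧ (fun k => M.ver k ω) ∈ V B ∧
    (∀ k ∈ A, M.charging (.horizontal k) ω = false) ∧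
    (∀ k ∈ B, M.charging (.vertical k) ω = false) ∧
    M.charging .source ω = false ∧ M.charging .destination ω = false ∧ M.placement ω = π}

open Classical in
/-- Source, destination and the roads with the given indices. -/
noncomputable def demandedRoads (A B : Finset ℕ) : Finset RoadIndex :=
  insert .source (insert .destination (A.image .horizontal ∪ B.image .vertical))

lemma card_demandedRoads (A B : Finset ℕ) : (demandedRoads A B).card = A.card + B.card + 2 := by
  classical
  unfold demandedRoads
  rw [Finset.card_insert_of_notMem (by simp), Finset.card_insert_of_notMem (by simp),
    Finset.card_union_of_disjoint, Finset.card_image_of_injective _ fun _ _ h => by simpa using h,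
    Finset.card_image_of_injective _ fun _ _ h => by simpa using h]
  rw [Finset.disjoint_left]
  intro i hi hi'
  obtain ⟨a, -, rfl⟩ := Finset.mem_image.1 hi
  simp at hi'

/-- On each piece the random set of demanded roads is a fixed finite set, so independence becomes
applicable. -/
lemma patternEvent_eq_iUnion (M : TripModel P lam p) (U V : Finset ℕ → Set (ℕ → ℝ))
    (π : Placement) : M.patternEvent U V π = ⋃ q : Finset ℕ × Finset ℕ,
      {ω | (((fun k => M.hor k ω) ∈ U q.1 ∧ (fun k => M.ver k ω) ∈ V q.2) ∧
        ∀ i ∈ demandedRoads q.1 q.2, M.charging i ω = false) ∧ M.placement ω = π} := by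
  ext ω
  simp only [patternEvent, demandedRoads, Set.mem_iUnion, Prod.exists, Finset.mem_insert,
    Finset.mem_union, Finset.mem_image, Set.mem_ofPred_eq]
  refine exists_congr fun A => exists_congr fun B => ?_
  constructor
  · rintro ⟨h1, h2, h3, h4, h5, h6, h7⟩
    refine ⟨⟨⟨h1, h2⟩, ?_⟩, h7⟩
    rintro i (rfl | rfl | ⟨k, hk, rfl⟩ | ⟨k, hk, rfl⟩)
    exacts [h5, h6, h3 k hk, h4 k hk]
  · rintro ⟨⟨⟨h1, h2⟩, h3⟩, h7⟩
    exact ⟨h1, h2, fun k hk => h3 _ (Or.inr (Or.inr (Or.inl ⟨k, hk, rfl⟩))),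
      fun k hk => h3 _ (Or.inr (Or.inr (Or.inr ⟨k, hk, rfl⟩))), h3 _ (Or.inl rfl),
      h3 _ (Or.inr (Or.inl rfl)), h7⟩

lemma measurableSet_pattern (M : TripModel P lam p) {U V : Set (ℕ → ℝ)} (hU : MeasurableSet U)
    (hV : MeasurableSet V) (I : Finset RoadIndex) (π : Placement) :
    MeasurableSet {ω | (((fun k => M.hor k ω) ∈ U ∧ (fun k => M.ver k ω) ∈ V) ∧
      ∀ i ∈ I, M.charging i ω = false) ∧ M.placement ω = π} := by
  have hI : MeasurableSet {ω | ∀ i ∈ I, M.charging i ω = false} := by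
    have : {ω | ∀ i ∈ I, M.charging i ω = false} = ⋂ i ∈ I, {ω | M.charging i ω = false} := by
      ext x
      simp
    rw [this]
    exact I.measurableSet_biInter fun i _ => M.measurableSet_charging_eq i false
  exact (((M.hor_poisson.measurable_path hU).inter (M.ver_poisson.measurable_path hV)).inter
    hI).inter (M.measurableSet_placement_eq π)

lemma measurableSet_patternEvent (M : TripModel P lam p) {U V : Finset ℕ → Set (ℕ → ℝ)}
    (hU : IsFamily U) (hV : IsFamily V) (π : Placement) :
    MeasurableSet (M.patternEvent U V π) := by
  rw [patternEvent_eq_iUnion]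
  exact MeasurableSet.iUnion fun q =>
    M.measurableSet_pattern (hU.measurableSet _) (hV.measurableSet _) _ π

/-- The pieces are disjoint because the positions determine both index sets. The double sum then
factorises; the square stems from the source and destination roads. -/
lemma measure_patternEvent [IsProbabilityMeasure P] (M : TripModel P lam p) (hp0 : 0 ≤ p)
    {U V : Finset ℕ → Set (ℕ → ℝ)} (hU : IsFamily U) (hV : IsFamily V) (π : Placement) :
    P (M.patternEvent U V π) = weight P (1 - p) M.hor U * weight P (1 - p) M.ver V *
      (ENNReal.ofReal (1 - p) ^ 2 * (1 / 2)) := by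
  rw [patternEvent_eq_iUnion, measure_iUnion]
  · unfold weight
    rw [← ENNReal.tsum_mul_right, ← ENNReal.tsum_mul_right, ENNReal.tsum_prod']
    refine tsum_congr fun A => ?_
    rw [← ENNReal.tsum_mul_left, ← ENNReal.tsum_mul_right]
    refine tsum_congr fun B => ?_
    rw [M.measure_roads_inter hp0 (hU.measurableSet A) (hV.measurableSet B), card_demandedRoads]
    ring
  · rintro ⟨A, B⟩ ⟨A', B'⟩ hne
    refine Set.disjoint_left.2 fun ω h h' => hne ?_
    rw [hU.disjoint A A' _ h.1.1.1 h'.1.1.1, hV.disjoint B B' _ h.1.1.2 h'.1.1.2]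
  · exact fun q => M.measurableSet_pattern (hU.measurableSet _) (hV.measurableSet _) _ π

lemma ae_generic [IsProbabilityMeasure P] (M : TripModel P lam p) (hlam : 0 ≤ lam)
    (S D : ℝ × ℝ) : ∀ᵐ ω ∂P, M.Generic S D ω := by
  filter_upwards [M.hor_poisson.distinct, M.ver_poisson.distinct, M.hor_poisson.ae_ne S.2,
    M.hor_poisson.ae_ne D.2, M.ver_poisson.ae_ne S.1, M.ver_poisson.ae_ne D.1,
    M.hor_poisson.ae_forall_finite hlam, M.ver_poisson.ae_forall_finite hlam,
    M.hor_poisson.ae_add_ne hlam (S.2 + D.2)] with ω h1 h2 h3 h4 h5 h6 h7 h8 h9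
  exact ⟨h1, h2, h3, h4, h5, h6, h7, h8, h9⟩

end TripModel

/-! ### Failure events as unions of pattern events -/

lemma finite_mem_uIoo {h : ℕ → ℝ} (hfin : ∀ L : ℝ, {k | |h k| ≤ L}.Finite) (a b : ℝ) :
    {k | h k ∈ Set.uIoo a b}.Finite := by
  refine (hfin (max |a| |b|)).subset fun k hk => ?_
  have h1 := mem_uIcc_of_mem_uIoo hk
  rw [Set.mem_uIcc] at h1
  rw [Set.mem_ofPred_eq, abs_le]
  have h2 := abs_le.1 (le_max_left |a| |b|)
  have h3 := abs_le.1 (le_max_right |a| |b|)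
  rcases h1 with h1 | h1 <;> constructor <;> linarith [h1.1, h1.2, h2.1, h2.2, h3.1, h3.2]

lemma exists_mem_pointsEq {h : ℕ → ℝ} {B : Set ℝ} {m : ℕ} (hfin : {k | h k ∈ B}.Finite)
    (hm : (m : ℕ∞) ≤ {k | h k ∈ B}.encard) :
    ∃ A : Finset ℕ, h ∈ pointsEq B m A ∧ ∀ k, k ∈ A ↔ h k ∈ B := by
  refine ⟨hfin.toFinset, ⟨?_, by simp⟩, by simp⟩
  rw [hfin.encard_eq_coe_toFinset_card] at hm
  exact_mod_cast hm

lemma mem_iff_of_mem_pointsEq {h : ℕ → ℝ} {B : Set ℝ} {m : ℕ} {A : Finset ℕ}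
    (hA : h ∈ pointsEq B m A) (k : ℕ) : k ∈ A ↔ h k ∈ B := by
  have := Set.ext_iff.1 hA.2 k
  simpa using this.symm

lemma le_encard_of_mem_pointsEq {h : ℕ → ℝ} {B : Set ℝ} {m : ℕ} {A : Finset ℕ}
    (hA : h ∈ pointsEq B m A) : (m : ℕ∞) ≤ {k | h k ∈ B}.encard := by
  rw [hA.2, Set.encard_coe_eq_coe_finsetCard]
  exact_mod_cast hA.1

lemma two_le_encard_iff {B : Set ℝ} {h : ℕ → ℝ} :
    ((2 : ℕ) : ℕ∞) ≤ {k | h k ∈ B}.encard ↔ ∃ k l, k ≠ l ∧ h k ∈ B ∧ h l ∈ B := by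
  rw [Nat.cast_ofNat, ← one_add_one_eq_two, ENat.add_one_le_iff ENat.one_ne_top,
    Set.one_lt_encard_iff]
  constructor
  · rintro ⟨k, l, hk, hl, hkl⟩
    exact ⟨k, l, hkl, hk, hl⟩
  · rintro ⟨k, l, hkl, hk, hl⟩
    exact ⟨k, l, hk, hl, hkl⟩

lemma one_le_encard_iff {B : Set ℝ} {h : ℕ → ℝ} :
    ((1 : ℕ) : ℕ∞) ≤ {k | h k ∈ B}.encard ↔ ∃ k, h k ∈ B := by
  rw [Nat.cast_one, Set.one_le_encard_iff_nonempty]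
  rfl

namespace TripModel

variable {Ω : Type*} [MeasurableSpace Ω] {P : Measure Ω} {lam p : ℝ}

/-- No point lies in `B`. -/
def noPoint (B : Set ℝ) : Set (ℕ → ℝ) := {x | ∀ k, x k ∉ B}

/-- Some point lies in `B`. -/
def somePoint (B : Set ℝ) : Set (ℕ → ℝ) := {x | ∃ k, x k ∈ B}

lemma measurableSet_noPoint {B : Set ℝ} (hB : MeasurableSet B) : MeasurableSet (noPoint B) := by
  have : noPoint B = {x | {k | x k ∈ B} = ∅} := by
    ext x
    simp [noPoint, Set.eq_empty_iff_forall_notMem]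
  rw [this]
  exact measurableSet_preimage_eq hB ∅

lemma measurableSet_somePoint {B : Set ℝ} (hB : MeasurableSet B) :
    MeasurableSet (somePoint B) := by
  have : somePoint B = (noPoint B)ᶜ := by
    ext x
    simp [noPoint, somePoint]
  rw [this]
  exact (measurableSet_noPoint hB).compl

/-- By local finiteness the roads in between form a finite index set, so asking all of them not to
charge is a demand of the admissible kind. -/
lemma Generic.mem_parallelFailure_iff {M : TripModel P lam p} {S D : ℝ × ℝ} {ω : Ω}
    (hg : M.Generic S D ω) : ω ∈ M.ParallelFailure S D ↔
      ω ∈ M.patternEvent (shortestDetour S.2 D.2) (noDemand Set.univ) .parallel ∪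
        M.patternEvent (pointsEq (Set.uIoo S.2 D.2) 2) (pointsEq (Set.uIoo S.1 D.1) 0)
          .parallel := by
  constructor
  · rintro ⟨⟨h1, h2, h3⟩, ⟨k, hk, hck⟩ | ⟨hkl, hch, hcv⟩⟩
    · exact Or.inl ⟨{k}, ∅, ⟨k, rfl, hk⟩, ⟨rfl, trivial⟩, by simpa using hck, by simp, h2, h3, h1⟩
    · obtain ⟨A, hA, hA'⟩ := exists_mem_pointsEq (finite_mem_uIoo hg.hor_finite S.2 D.2)
        (two_le_encard_iff.2 hkl)
      obtain ⟨B, hB, hB'⟩ := exists_mem_pointsEq (m := 0) (finite_mem_uIoo hg.ver_finite S.1 D.1)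
        (by simp)
      exact Or.inr ⟨A, B, hA, hB, fun k hk => hch k ((hA' k).1 hk),
        fun k hk => hcv k ((hB' k).1 hk), h2, h3, h1⟩
  · rintro (⟨A, B, ⟨k, rfl, hk⟩, -, hch, -, h2, h3, h1⟩ | ⟨A, B, hA, hB, hch, hcv, h2, h3, h1⟩)
    · exact ⟨⟨h1, h2, h3⟩, Or.inl ⟨k, hk, hch k (by simp)⟩⟩
    · exact ⟨⟨h1, h2, h3⟩, Or.inr ⟨two_le_encard_iff.1 (le_encard_of_mem_pointsEq hA),
        fun k hk => hch k ((mem_iff_of_mem_pointsEq hA k).2 hk),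
        fun k hk => hcv k ((mem_iff_of_mem_pointsEq hB k).2 hk)⟩⟩

lemma Generic.mem_perpendicularFailure_iff {M : TripModel P lam p} {S D : ℝ × ℝ} {ω : Ω}
    (hg : M.Generic S D ω) : ω ∈ M.PerpendicularFailure S D ↔
      ω ∈ M.patternEvent (noDemand (noPoint (Set.uIoo S.2 D.2))) (noDemand Set.univ)
          .perpendicular ∪
        (M.patternEvent (noDemand (somePoint (Set.uIoo S.2 D.2)))
          (noDemand (noPoint (Set.uIoo S.1 D.1))) .perpendicular ∪
        M.patternEvent (pointsEq (Set.uIoo S.2 D.2) 1) (pointsEq (Set.uIoo S.1 D.1) 1)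
          .perpendicular) := by
  constructor
  · rintro ⟨⟨h1, h2, h3⟩, hW | ⟨hW, hW'⟩ | ⟨hW, hW', hch, hcv⟩⟩
    · exact Or.inl ⟨∅, ∅, ⟨rfl, hW⟩, ⟨rfl, trivial⟩, by simp, by simp, h2, h3, h1⟩
    · exact Or.inr (Or.inl ⟨∅, ∅, ⟨rfl, hW⟩, ⟨rfl, hW'⟩, by simp, by simp, h2, h3, h1⟩)
    · obtain ⟨A, hA, hA'⟩ := exists_mem_pointsEq (finite_mem_uIoo hg.hor_finite S.2 D.2)
        (one_le_encard_iff.2 hW)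
      obtain ⟨B, hB, hB'⟩ := exists_mem_pointsEq (finite_mem_uIoo hg.ver_finite S.1 D.1)
        (one_le_encard_iff.2 hW')
      exact Or.inr (Or.inr ⟨A, B, hA, hB, fun k hk => hch k ((hA' k).1 hk),
        fun k hk => hcv k ((hB' k).1 hk), h2, h3, h1⟩)
  · rintro (⟨A, B, hA, -, -, -, h2, h3, h1⟩ | ⟨A, B, hA, hB, -, -, h2, h3, h1⟩ |
      ⟨A, B, hA, hB, hch, hcv, h2, h3, h1⟩)
    · exact ⟨⟨h1, h2, h3⟩, Or.inl hA.2⟩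
    · exact ⟨⟨h1, h2, h3⟩, Or.inr (Or.inl ⟨hA.2, hB.2⟩)⟩
    · exact ⟨⟨h1, h2, h3⟩, Or.inr (Or.inr ⟨one_le_encard_iff.1 (le_encard_of_mem_pointsEq hA),
        one_le_encard_iff.1 (le_encard_of_mem_pointsEq hB),
        fun k hk => hch k ((mem_iff_of_mem_pointsEq hA k).2 hk),
        fun k hk => hcv k ((mem_iff_of_mem_pointsEq hB k).2 hk)⟩)⟩

lemma measurableSet_E4 (M : TripModel P lam p) : MeasurableSet M.E4 :=
  (M.measurableSet_placement_eq _).inter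
    ((M.measurableSet_charging_eq _ _).inter (M.measurableSet_charging_eq _ _))

lemma measurableSet_E8 (M : TripModel P lam p) : MeasurableSet M.E8 :=
  (M.measurableSet_placement_eq _).inter
    ((M.measurableSet_charging_eq _ _).inter (M.measurableSet_charging_eq _ _))

lemma disjoint_failures (M : TripModel P lam p) (S D : ℝ × ℝ) :
    Disjoint (M.ParallelFailure S D) (M.PerpendicularFailure S D) :=
  Set.disjoint_left.2 fun _ h h' => Placement.noConfusion (h.1.1.symm.trans h'.1.1)

/-! ### Closed forms of the failure probabilities -/

variable [IsProbabilityMeasure P]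

lemma parallelFailure_ae_eq (M : TripModel P lam p) (hlam : 0 ≤ lam) (S D : ℝ × ℝ) :
    M.ParallelFailure S D =ᵐ[P]
      (M.patternEvent (shortestDetour S.2 D.2) (noDemand Set.univ) .parallel ∪
        M.patternEvent (pointsEq (Set.uIoo S.2 D.2) 2) (pointsEq (Set.uIoo S.1 D.1) 0)
          .parallel : Set Ω) := by
  filter_upwards [M.ae_generic hlam S D] with ω hg
  exact propext hg.mem_parallelFailure_iff

lemma perpendicularFailure_ae_eq (M : TripModel P lam p) (hlam : 0 ≤ lam) (S D : ℝ × ℝ) :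
    M.PerpendicularFailure S D =ᵐ[P]
      (M.patternEvent (noDemand (noPoint (Set.uIoo S.2 D.2))) (noDemand Set.univ)
          .perpendicular ∪
        (M.patternEvent (noDemand (somePoint (Set.uIoo S.2 D.2)))
          (noDemand (noPoint (Set.uIoo S.1 D.1))) .perpendicular ∪
        M.patternEvent (pointsEq (Set.uIoo S.2 D.2) 1) (pointsEq (Set.uIoo S.1 D.1) 1)
          .perpendicular) : Set Ω) := by
  filter_upwards [M.ae_generic hlam S D] with ω hg
  exact propext hg.mem_perpendicularFailure_iff

lemma isFamily_noDemand_univ : IsFamily (noDemand Set.univ) := isFamily_noDemand MeasurableSet.univ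

lemma nullMeasurableSet_parallelFailure (M : TripModel P lam p) (hlam : 0 ≤ lam)
    (S D : ℝ × ℝ) : NullMeasurableSet (M.ParallelFailure S D) P :=
  ((M.measurableSet_patternEvent (isFamily_shortestDetour _ _) isFamily_noDemand_univ _).union
    (M.measurableSet_patternEvent (isFamily_pointsEq measurableSet_Ioo _)
      (isFamily_pointsEq measurableSet_Ioo _) _)).nullMeasurableSet.congr
    (M.parallelFailure_ae_eq hlam S D).symm

lemma nullMeasurableSet_perpendicularFailure (M : TripModel P lam p) (hlam : 0 ≤ lam)
    (S D : ℝ × ℝ) : NullMeasurableSet (M.PerpendicularFailure S D) P :=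
  ((M.measurableSet_patternEvent (isFamily_noDemand (measurableSet_noPoint measurableSet_Ioo))
    isFamily_noDemand_univ _).union
    ((M.measurableSet_patternEvent
      (isFamily_noDemand (measurableSet_somePoint measurableSet_Ioo))
      (isFamily_noDemand (measurableSet_noPoint measurableSet_Ioo)) _).union
    (M.measurableSet_patternEvent (isFamily_pointsEq measurableSet_Ioo _)
      (isFamily_pointsEq measurableSet_Ioo _) _))).nullMeasurableSet.congr
    (M.perpendicularFailure_ae_eq hlam S D).symm

lemma exp_split (lam p d : ℝ) : Real.exp (-(lam * (1 - p) * d)) * Real.exp (-(lam * p * d)) =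
    Real.exp (-(lam * d)) := by
  rw [← Real.exp_add]
  congr 1
  ring

lemma measureReal_parallelFailure (M : TripModel P lam p) (hlam : 0 ≤ lam) (hp0 : 0 ≤ p)
    (hp1 : p ≤ 1) (S D : ℝ × ℝ) {dh dv : ℝ} (hdh : |D.1 - S.1| = dh) (hdv : |D.2 - S.2| = dv) :
    P.real (M.ParallelFailure S D) = (Real.exp (-(lam * dv)) * (1 - p) +
        lam * (1 - p) * dv * Real.exp (-(lam * (1 - p) * dv)) * Real.exp (-(lam * p * dv)) +
        Real.exp (-(lam * p * dv)) *
          (1 - Real.exp (-(lam * (1 - p) * dv)) -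
            lam * (1 - p) * dv * Real.exp (-(lam * (1 - p) * dv))) *
          Real.exp (-(lam * p * dh))) * ((1 - p) ^ 2 / 2) := by
  have hq : 0 ≤ 1 - p := by linarith
  have hdv0 : 0 ≤ dv := hdv ▸ abs_nonneg _
  have hdh0 : 0 ≤ dh := hdh ▸ abs_nonneg _
  have hvol : volume (Set.uIoo S.2 D.2) = ENNReal.ofReal dv := by rw [Real.volume_uIoo, hdv]
  have hvol' : volume (Set.uIoo S.1 D.1) = ENNReal.ofReal dh := by rw [Real.volume_uIoo, hdh]
  have hB : MeasurableSet (Set.uIoo S.2 D.2) := measurableSet_Ioo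
  have hB' : MeasurableSet (Set.uIoo S.1 D.1) := measurableSet_Ioo
  have hmeas := M.measurableSet_patternEvent (isFamily_pointsEq hB 2) (isFamily_pointsEq hB' 0)
    .parallel
  have hdisj : Disjoint
      (M.patternEvent (shortestDetour S.2 D.2) (noDemand Set.univ) .parallel)
      (M.patternEvent (pointsEq (Set.uIoo S.2 D.2) 2) (pointsEq (Set.uIoo S.1 D.1) 0)
        .parallel) := by
    refine Set.disjoint_left.2 ?_
    rintro ω ⟨A, B, ⟨k, rfl, hk⟩, -⟩ ⟨A', B', hA', -⟩
    obtain ⟨i, j, hij, hi, hj⟩ := two_le_encard_iff.1 (le_encard_of_mem_pointsEq hA')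
    exact not_shortestDetour_of_mem_uIoo (h := fun k => M.hor k ω) hij hi hj hk
  -- Needed because `ENNReal.ofReal` truncates at zero; it is `1 + x ≤ exp x` at `x = lam * (1 - p)
  -- * dv`, scaled by `exp (-(lam * dv))`.
  have hpos2 : 0 ≤ Real.exp (-(lam * (1 - (1 - p)) * dv)) - ∑ n ∈ Finset.range 2,
      (lam * dv * (1 - p)) ^ n / n.factorial * Real.exp (-(lam * dv)) := by
    have h1 := Real.add_one_le_exp (lam * (1 - p) * dv)
    have h2 : Real.exp (-(lam * (1 - (1 - p)) * dv)) =
        Real.exp (lam * (1 - p) * dv) * Real.exp (-(lam * dv)) := by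
      rw [← Real.exp_add]
      congr 1
      ring
    rw [h2]
    simp only [Finset.sum_range_succ, Finset.sum_range_zero, pow_zero, pow_one,
      Nat.factorial_zero, Nat.factorial_one, Nat.cast_one, div_one, zero_add]
    nlinarith [Real.exp_pos (-(lam * dv))]
  rw [measureReal_congr (M.parallelFailure_ae_eq hlam S D), measureReal_union hdisj hmeas]
  simp only [measureReal_def]
  rw [M.measure_patternEvent hp0 (isFamily_shortestDetour _ _) isFamily_noDemand_univ,
    M.measure_patternEvent hp0 (isFamily_pointsEq hB 2) (isFamily_pointsEq hB' 0),
    M.hor_poisson.weight_shortestDetour hlam, IsPoissonProcess.weight_noDemand,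
    M.hor_poisson.weight_pointsEq hlam hB hdv0 hvol hq,
    M.ver_poisson.weight_pointsEq hlam hB' hdh0 hvol' hq, hdv]
  simp only [Set.mem_univ, Set.ofPred_true, measure_univ, mul_one, ENNReal.toReal_mul,
    ENNReal.toReal_pow, ENNReal.toReal_div, ENNReal.toReal_one, ENNReal.toReal_ofNat,
    ENNReal.toReal_ofReal hq, ENNReal.toReal_ofReal hpos2]
  rw [ENNReal.toReal_ofReal (by positivity), ENNReal.toReal_ofReal (by simp; positivity)]
  simp only [Finset.sum_range_succ, Finset.sum_range_zero, pow_zero, pow_one,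
      Nat.factorial_zero, Nat.factorial_one, Nat.cast_one, div_one, zero_add, sub_sub_cancel,
      one_mul, sub_zero]
  rw [← exp_split lam p dv]
  ring

/-- The three patterns do not match the three summands one by one: the part of the third that
carries `exp (-(lam * dh))` merges with the second, leaving the factor `1 - exp (-(lam * p * dv))`.
-/
lemma measureReal_perpendicularFailure (M : TripModel P lam p) (hlam : 0 ≤ lam) (hp0 : 0 ≤ p)
    (hp1 : p ≤ 1) (S D : ℝ × ℝ) {dh dv : ℝ} (hdh : |D.1 - S.1| = dh) (hdv : |D.2 - S.2| = dv) :
    P.real (M.PerpendicularFailure S D) = (Real.exp (-(lam * dv)) +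
        Real.exp (-(lam * p * dv)) * (1 - Real.exp (-(lam * (1 - p) * dv))) *
          Real.exp (-(lam * p * dh)) +
        (1 - Real.exp (-(lam * p * dv))) * Real.exp (-(lam * dh))) * ((1 - p) ^ 2 / 2) := by
  have hq : 0 ≤ 1 - p := by linarith
  have hdv0 : 0 ≤ dv := hdv ▸ abs_nonneg _
  have hdh0 : 0 ≤ dh := hdh ▸ abs_nonneg _
  have hvol : volume (Set.uIoo S.2 D.2) = ENNReal.ofReal dv := by rw [Real.volume_uIoo, hdv]
  have hvol' : volume (Set.uIoo S.1 D.1) = ENNReal.ofReal dh := by rw [Real.volume_uIoo, hdh]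
  have hB : MeasurableSet (Set.uIoo S.2 D.2) := measurableSet_Ioo
  have hB' : MeasurableSet (Set.uIoo S.1 D.1) := measurableSet_Ioo
  have hF0 := isFamily_noDemand (measurableSet_noPoint hB)
  have hF0' := isFamily_noDemand (measurableSet_noPoint hB')
  have hF1 := isFamily_noDemand (measurableSet_somePoint hB)
  have hG := isFamily_pointsEq hB 1
  have hG' := isFamily_pointsEq hB' 1
  have hm3 := M.measurableSet_patternEvent hG hG' .perpendicular
  have hm2 := M.measurableSet_patternEvent hF1 hF0' .perpendicular
  have hd23 : Disjoint
      (M.patternEvent (noDemand (somePoint (Set.uIoo S.2 D.2)))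
        (noDemand (noPoint (Set.uIoo S.1 D.1))) .perpendicular)
      (M.patternEvent (pointsEq (Set.uIoo S.2 D.2) 1) (pointsEq (Set.uIoo S.1 D.1) 1)
        .perpendicular) := by
    refine Set.disjoint_left.2 ?_
    rintro ω ⟨A, B, -, hB, -⟩ ⟨A', B', -, hB', -⟩
    obtain ⟨i, hi⟩ := one_le_encard_iff.1 (le_encard_of_mem_pointsEq hB')
    exact hB.2 i hi
  have hd1 : Disjoint
      (M.patternEvent (noDemand (noPoint (Set.uIoo S.2 D.2))) (noDemand Set.univ) .perpendicular)
      (M.patternEvent (noDemand (somePoint (Set.uIoo S.2 D.2)))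
          (noDemand (noPoint (Set.uIoo S.1 D.1))) .perpendicular ∪
        M.patternEvent (pointsEq (Set.uIoo S.2 D.2) 1) (pointsEq (Set.uIoo S.1 D.1) 1)
          .perpendicular) := by
    refine Set.disjoint_left.2 ?_
    rintro ω ⟨A, B, hA, -⟩ (⟨A', B', hA', -⟩ | ⟨A', B', hA', -⟩)
    · obtain ⟨i, hi⟩ := hA'.2
      exact hA.2 i hi
    · obtain ⟨i, hi⟩ := one_le_encard_iff.1 (le_encard_of_mem_pointsEq hA')
      exact hA.2 i hi
  have hpos : ∀ d : ℝ, 0 ≤ d → 0 ≤ Real.exp (-(lam * (1 - (1 - p)) * d)) -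
      ∑ n ∈ Finset.range 1, (lam * d * (1 - p)) ^ n / n.factorial * Real.exp (-(lam * d)) := by
    intro d hd
    have h1 : lam * (1 - (1 - p)) * d ≤ lam * d := by
      have : 0 ≤ lam * d * (1 - p) := by positivity
      linarith
    have h2 := Real.exp_le_exp.2 (neg_le_neg h1)
    simpa using h2
  have hw0 : ∀ d : ℝ, 0 ≤ d → 0 ≤ 1 - Real.exp (-(lam * d)) := by
    intro d hd
    have : Real.exp (-(lam * d)) ≤ 1 := Real.exp_le_one_iff.2 (by
      have : 0 ≤ lam * d := by positivity
      linarith)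
    linarith
  rw [measureReal_congr (M.perpendicularFailure_ae_eq hlam S D),
    measureReal_union hd1 (hm2.union hm3), measureReal_union hd23 hm3]
  simp only [measureReal_def]
  rw [M.measure_patternEvent hp0 hF0 isFamily_noDemand_univ, M.measure_patternEvent hp0 hF1 hF0',
    M.measure_patternEvent hp0 hG hG', IsPoissonProcess.weight_noDemand,
    IsPoissonProcess.weight_noDemand, IsPoissonProcess.weight_noDemand,
    IsPoissonProcess.weight_noDemand,
    M.hor_poisson.weight_pointsEq hlam hB hdv0 hvol hq,
    M.ver_poisson.weight_pointsEq hlam hB' hdh0 hvol' hq]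
  have e1 : P {ω | (fun k => M.hor k ω) ∈ noPoint (Set.uIoo S.2 D.2)} =
      ENNReal.ofReal (Real.exp (-(lam * dv))) := M.hor_poisson.measure_forall_notMem hB hdv0 hvol
  have e2 : P {ω | (fun k => M.hor k ω) ∈ somePoint (Set.uIoo S.2 D.2)} =
      ENNReal.ofReal (1 - Real.exp (-(lam * dv))) := M.hor_poisson.measure_exists_mem hB hdv0 hvol
  have e3 : P {ω | (fun k => M.ver k ω) ∈ noPoint (Set.uIoo S.1 D.1)} =
      ENNReal.ofReal (Real.exp (-(lam * dh))) := M.ver_poisson.measure_forall_notMem hB' hdh0 hvol'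
  rw [e1, e2, e3]
  simp only [Set.mem_univ, Set.ofPred_true, measure_univ, mul_one, ENNReal.toReal_mul,
    ENNReal.toReal_pow, ENNReal.toReal_div, ENNReal.toReal_one, ENNReal.toReal_ofNat,
    ENNReal.toReal_ofReal hq, ENNReal.toReal_ofReal (hpos dv hdv0),
    ENNReal.toReal_ofReal (hpos dh hdh0), ENNReal.toReal_ofReal (hw0 dv hdv0),
    ENNReal.toReal_ofReal (Real.exp_pos _).le]
  simp only [Finset.sum_range_succ, Finset.sum_range_zero, pow_zero,
      Nat.factorial_zero, Nat.cast_one, div_one, zero_add, sub_sub_cancel, one_mul]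
  rw [← exp_split lam p dv, ← exp_split lam p dh]
  ring

/-! ### Conditional probabilities and conclusion -/

lemma cond_real_mul_real {E F W : Set Ω} (hE : MeasurableSet E) (h : (E ∩ F : Set Ω) =ᵐ[P] W) :
    (P[|E]).real F * P.real E = P.real W := by
  rw [← measureReal_congr h, measureReal_def, cond_apply hE]
  simp only [measureReal_def, ENNReal.toReal_mul, ENNReal.toReal_inv]
  -- For a null event both sides vanish, in accordance with the convention for the product.
  by_cases h0 : P E = 0
  · rw [h0, measure_mono_null Set.inter_subset_left h0]
    simp
  · have : (P E).toReal ≠ 0 := ENNReal.toReal_ne_zero.2 ⟨h0, measure_ne_top _ _⟩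
    field_simp

lemma E4_inter_ae_eq (M : TripModel P lam p) (hlam : 0 ≤ lam) {S D : ℝ × ℝ} (h1 : S.1 ≠ D.1)
    (h2 : S.2 ≠ D.2) : (M.E4 ∩ (M.Tc S D)ᶜ : Set Ω) =ᵐ[P] M.ParallelFailure S D := by
  filter_upwards [M.ae_generic hlam S D] with ω hg
  refine propext ⟨fun h => ?_, fun h => ⟨h.1, fun hT => (hg.mem_Tc_iff h1 h2).1 hT (Or.inl h)⟩⟩
  have h3 : ω ∈ M.ParallelFailure S D ∪ M.PerpendicularFailure S D := by
    by_contra hn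
    exact h.2 ((hg.mem_Tc_iff h1 h2).2 hn)
  exact h3.resolve_right fun h' => Placement.noConfusion (h.1.1.symm.trans h'.1.1)

lemma E8_inter_ae_eq (M : TripModel P lam p) (hlam : 0 ≤ lam) {S D : ℝ × ℝ} (h1 : S.1 ≠ D.1)
    (h2 : S.2 ≠ D.2) : (M.E8 ∩ (M.Tc S D)ᶜ : Set Ω) =ᵐ[P] M.PerpendicularFailure S D := by
  filter_upwards [M.ae_generic hlam S D] with ω hg
  refine propext ⟨fun h => ?_, fun h => ⟨h.1, fun hT => (hg.mem_Tc_iff h1 h2).1 hT (Or.inr h)⟩⟩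
  have h3 : ω ∈ M.ParallelFailure S D ∪ M.PerpendicularFailure S D := by
    by_contra hn
    exact h.2 ((hg.mem_Tc_iff h1 h2).2 hn)
  exact h3.resolve_left fun h' => Placement.noConfusion (h'.1.1.symm.trans h.1.1)

lemma Tc_ae_eq (M : TripModel P lam p) (hlam : 0 ≤ lam) {S D : ℝ × ℝ} (h1 : S.1 ≠ D.1)
    (h2 : S.2 ≠ D.2) :
    M.Tc S D =ᵐ[P] ((M.ParallelFailure S D ∪ M.PerpendicularFailure S D)ᶜ : Set Ω) := by
  filter_upwards [M.ae_generic hlam S D] with ω hg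
  exact propext (hg.mem_Tc_iff h1 h2)

end TripModel

end ChargingRoads

/-- Almost surely the policy prescribes a route, using a charging road is an event, and its
probability is one minus the contributions of `E4` and `E8`, which are given in closed form. -/
theorem theorem2 {Ω : Type*} [MeasurableSpace Ω] (P : Measure Ω) [IsProbabilityMeasure P]
    (lam p : ℝ) (hlam : 0 < lam) (hp0 : 0 ≤ p) (hp1 : p ≤ 1)
    (M : ChargingRoads.TripModel P lam p)
    (S D : ℝ × ℝ) (dh dv : ℝ) (hdh : |D.1 - S.1| = dh) (hdv : |D.2 - S.2| = dv)
    (hdh_pos : 0 < dh) (hdv_pos : 0 < dv) :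
    (∀ᵐ ω ∂P, ∃ r : ChargingRoads.Route (M.network S D ω) S D, r.IsPolicyRoute) ∧
    NullMeasurableSet (M.Tc S D) P ∧
    P.real (M.Tc S D) =
      1 - ((P[|M.E4]).real (M.Tc S D)ᶜ * P.real M.E4 +
        (P[|M.E8]).real (M.Tc S D)ᶜ * P.real M.E8) ∧
    (P[|M.E4]).real (M.Tc S D)ᶜ * P.real M.E4 =
      (Real.exp (-(lam * dv)) * (1 - p) +
        lam * (1 - p) * dv * Real.exp (-(lam * (1 - p) * dv)) * Real.exp (-(lam * p * dv)) +
        Real.exp (-(lam * p * dv)) *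
          (1 - Real.exp (-(lam * (1 - p) * dv)) -
            lam * (1 - p) * dv * Real.exp (-(lam * (1 - p) * dv))) *
          Real.exp (-(lam * p * dh))) * ((1 - p) ^ 2 / 2) ∧
    (P[|M.E8]).real (M.Tc S D)ᶜ * P.real M.E8 =
      (Real.exp (-(lam * dv)) +
        Real.exp (-(lam * p * dv)) * (1 - Real.exp (-(lam * (1 - p) * dv))) *
          Real.exp (-(lam * p * dh)) +
        (1 - Real.exp (-(lam * p * dv))) * Real.exp (-(lam * dh))) * ((1 - p) ^ 2 / 2) := by
  have h1 : S.1 ≠ D.1 := fun h => by simp [h] at hdh; exact hdh_pos.ne hdh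
  have h2 : S.2 ≠ D.2 := fun h => by simp [h] at hdv; exact hdv_pos.ne hdv
  have e4 := ChargingRoads.TripModel.cond_real_mul_real M.measurableSet_E4
    (M.E4_inter_ae_eq hlam.le h1 h2)
  have e8 := ChargingRoads.TripModel.cond_real_mul_real M.measurableSet_E8
    (M.E8_inter_ae_eq hlam.le h1 h2)
  have n4 := M.nullMeasurableSet_parallelFailure hlam.le S D
  have n8 := M.nullMeasurableSet_perpendicularFailure hlam.le S D
  have hT := M.Tc_ae_eq hlam.le h1 h2
  refine ⟨?_, (n4.union n8).compl.congr hT.symm, ?_, ?_, ?_⟩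
  · filter_upwards [M.ae_generic hlam.le S D] with ω hg
    exact hg.exists_isPolicyRoute h1
  -- Up to a null set, the complement of `Tc` is the disjoint union of the two failure events.
  · rw [e4, e8, measureReal_congr hT, probReal_compl_eq_one_sub₀ (n4.union n8),
      measureReal_union₀ n8 (M.disjoint_failures S D).aedisjoint]
  · rw [e4, M.measureReal_parallelFailure hlam.le hp0 hp1 S D hdh hdv]
  · rw [e8, M.measureReal_perpendicularFailure hlam.le hp0 hp1 S D hdh hdv]
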